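/- Let $\mathbb T=\mathbb R/\mathbb Z$ with Lebesgue measure, and let $\mathcal D'(\mathbb T)$ be the space of complex-valued periodic distributions, with the $\sigma$-algebra generated by the evaluations $u\mapsto\langle u,\varphi\rangle$, $\varphi\in C^\infty(\mathbb T)$. Let $\mu$ be the centred Gaussian probability measure on $\mathcal D'(\mathbb T)$ with inverse covariance $1-\Delta$ (with respect to the real inner product $\operatorname{Re}\int_{\mathbb T} f\bar g\,dx$), formally $d\mu(u)=\frac1Z e^{-\frac12\int_{\mathbb T}|u|^2dx-\frac12\int_{\mathbb T}|\partial_xu|^2dx}\,du$; that is, $\mu$ is the law of the random Fourier series $\sum_{n\in\mathbb Z}\frac{g_n}{\sqrt{1+4\pi^2n^2}}e^{2\pi i nx}$, where $\operatorname{Re}g_n,\operatorname{Im}g_n$ $(n\in\mathbb Z)$ are independent real Gaussian random variables with mean $0$ and variance $1$. For $r\in\{2,6\}$ put $\int_{\mathbb T}|u|^r\,dx=\infty$ if $u\notin L^r(\mathbb T)$, and let $M(u)=\int_{\mathbb T}|u|^2\,dx$. Let $Q:\mathbb R\to\mathbb R$ be an even, positive optimiser in $H^1(\mathbb R)$ of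 the Gagliardo–Nirenberg–Sobolev inequality $$\|u\|_{L^6(\mathbb R)}^6\le C\,\|u\|_{L^2(\mathbb R)}^4\,\|\partial_xu\|_{L^2(\mathbb R)}^2,\qquad u\in H^1(\mathbb R),$$ (that is, equality holds for $u=Q$ with $C$ the optimal constant), normalised by $\|Q\|_{L^6(\mathbb R)}^6=3\|\partial_xQ\|_{L^2(\mathbb R)}^2$. Then for every real $p>1$ the integrand below is $\mu$-measurable and $$\int_{\mathcal D'(\mathbb T)}e^{\frac p6\int_{\mathbb T}|u|^6\,dx}\,\mathbf 1_{\{M(u)\le\|Q\|_{L^2(\mathbb R)}^2\}}\,d\mu(u)=\infty .$$ Equivalently, for every normalising constant $Z\in(0,\infty)$, the ($\mu$-measurable) Gibbs density $Z^{-1}e^{\frac16\int_{\mathbb T}|u|^6\,dx}\,\mathbf 1_{\{M(u)\le\|Q\|_{L^2(\mathbb R)}^2\}}$ at the optimal mass threshold does not belong to $L^p(\mu)$ for any real $p>1$. -/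

import Mathlib

open MeasureTheory ProbabilityTheory
open scoped ENNReal ContDiff

noncomputable section

namespace TorusGibbs

/-! ### The Gagliardo-Nirenberg-Sobolev optimiser on the real line -/

/-- `u ∈ H¹(ℝ)` with weak derivative `u'`: both are square integrable, and
`∫ φ' u = - ∫ φ u'` for all test functions `φ ∈ C_c^∞(ℝ)`. -/
def IsH1WithDeriv (u u' : ℝ → ℂ) : Prop :=
  MemLp u 2 volume ∧ MemLp u' 2 volume ∧
    ∀ φ : ℝ → ℝ, ContDiff ℝ ∞ φ → HasCompactSupport φ →
      ∫ x, ((deriv φ x : ℝ) : ℂ) * u x = - ∫ x, (φ x : ℂ) * u' x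

/-- The optimal constant `C` in `‖u‖_{L⁶(ℝ)}⁶ ≤ C ‖u‖_{L²(ℝ)}⁴ ‖∂ₓu‖_{L²(ℝ)}²`, `u ∈ H¹(ℝ)`. -/
def gnsConst : ℝ≥0∞ :=
  sInf {C : ℝ≥0∞ | ∀ u u' : ℝ → ℂ, IsH1WithDeriv u u' →
    eLpNorm u 6 volume ^ 6 ≤ C * eLpNorm u 2 volume ^ 4 * eLpNorm u' 2 volume ^ 2}

/-- `Q` is an even and positive optimiser of the Gagliardo-Nirenberg-Sobolev inequality
with exponent `6`, normalised by `‖Q‖_{L⁶(ℝ)}⁶ = 3 ‖∂ₓQ‖_{L²(ℝ)}²`. -/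
def IsGNSOptimiser (Q : ℝ → ℝ) : Prop :=
  (∀ x, 0 < Q x) ∧ (∀ x, Q (-x) = Q x) ∧
    ∃ Q' : ℝ → ℂ, IsH1WithDeriv (fun x => (Q x : ℂ)) Q' ∧
      eLpNorm Q 6 volume ^ 6 = gnsConst * eLpNorm Q 2 volume ^ 4 * eLpNorm Q' 2 volume ^ 2 ∧
      eLpNorm Q 6 volume ^ 6 = 3 * eLpNorm Q' 2 volume ^ 2

/-! ### Periodic distributions -/

/-- The torus `ℝ / ℤ` carries its Haar probability measure. -/
abbrev haarT : Measure UnitAddCircle := AddCircle.haarAddCircle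

/-- The space `C^∞(𝕋)` of smooth complex-valued functions on the torus. -/
def SmoothTorus : Submodule ℂ (UnitAddCircle → ℂ) where
  carrier := {φ | ContDiff ℝ ∞ (fun x : ℝ => φ (x : UnitAddCircle))}
  add_mem' := fun {a b} (ha : ContDiff ℝ ∞ fun x : ℝ => a (x : UnitAddCircle))
      (hb : ContDiff ℝ ∞ fun x : ℝ => b (x : UnitAddCircle)) => ha.add hb
  zero_mem' := (contDiff_const : ContDiff ℝ ∞ fun _ : ℝ => (0 : ℂ))
  smul_mem' := fun c f (hf : ContDiff ℝ ∞ fun x : ℝ => f (x : UnitAddCircle)) =>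
    (contDiff_const (c := c)).mul hf

/-- The space `𝒟'(𝕋)` of periodic distributions: linear functionals on `C^∞(𝕋)` that are
continuous, i.e. bounded by a multiple of one of the `C^N` norms. -/
structure TorusDistribution where
  toLin : SmoothTorus →ₗ[ℂ] ℂ
  bound : ∃ (N : ℕ) (C : ℝ), ∀ (φ : SmoothTorus) (B : ℝ),
    (∀ k ≤ N, ∀ x : ℝ, ‖iteratedDeriv k (fun y : ℝ => φ.1 (y : UnitAddCircle)) x‖ ≤ B) →
      ‖toLin φ‖ ≤ C * B

/-- The cylindrical `σ`-algebra on `𝒟'(𝕋)`, generated by the evaluations `u ↦ ⟨u, φ⟩`. -/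
instance : MeasurableSpace TorusDistribution :=
  ⨆ φ : SmoothTorus, MeasurableSpace.comap (fun u : TorusDistribution => u.toLin φ) inferInstance

/-- The distribution `u` is the integrable function `f`. -/
def TorusDistribution.IsFunction (u : TorusDistribution) (f : UnitAddCircle → ℂ) : Prop :=
  Integrable f haarT ∧ ∀ φ : SmoothTorus, u.toLin φ = ∫ x, φ.1 x * f x ∂haarT

/-- `∫_𝕋 |u|^r dx` for a distribution `u`. If `u` is a function `f` (which is unique up to null
sets), this is `∫_𝕋 |f|^r dx`; otherwise it is `∞`. -/
def TorusDistribution.powInt (r : ℝ) (u : TorusDistribution) : ℝ≥0∞ :=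
  ⨅ (f : UnitAddCircle → ℂ) (_ : u.IsFunction f), ∫⁻ x, ‖f x‖ₑ ^ r ∂haarT

/-- The mass `M(u) = ∫_𝕋 |u|² dx`. -/
def TorusDistribution.mass (u : TorusDistribution) : ℝ≥0∞ := u.powInt 2

theorem SmoothTorus.continuous (φ : SmoothTorus) : Continuous φ.1 := by
  have h : ContDiff ℝ ∞ (fun x : ℝ => φ.1 (x : UnitAddCircle)) := φ.2
  exact (QuotientAddGroup.isQuotientMap_mk (N := AddSubgroup.zmultiples (1 : ℝ))).continuous_iff.2
    h.continuous

theorem SmoothTorus.memLp (φ : SmoothTorus) : MemLp φ.1 2 haarT :=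
  (SmoothTorus.continuous φ).memLp_of_hasCompactSupport
    (HasCompactSupport.of_compactSpace φ.1)

theorem SmoothTorus.integrable_mul (φ : SmoothTorus) (f : Lp ℂ 2 haarT) :
    Integrable (fun x => φ.1 x * f x) haarT :=
  (SmoothTorus.memLp φ).integrable_mul (Lp.memLp f)

/-- The distribution `φ ↦ ∫_𝕋 φ f dx` given by a function `f ∈ L²(𝕋)`. -/
def TorusDistribution.ofLp (f : Lp ℂ 2 haarT) : TorusDistribution where
  toLin :=
    { toFun := fun φ => ∫ x, φ.1 x * f x ∂haarT
      map_add' := fun φ ψ => by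
        rw [← integral_add (SmoothTorus.integrable_mul φ f) (SmoothTorus.integrable_mul ψ f)]
        simp [add_mul]
      map_smul' := fun c φ => by
        simp only [Submodule.coe_smul, Pi.smul_apply, smul_eq_mul, RingHom.id_apply, mul_assoc]
        exact integral_const_mul c _ }
  bound := by
    refine ⟨0, ∫ x, ‖f x‖ ∂haarT, fun φ B h => ?_⟩
    have hB : ∀ x : UnitAddCircle, ‖φ.1 x‖ ≤ B := by
      intro x
      obtain ⟨y, rfl⟩ := QuotientAddGroup.mk_surjective x
      simpa using h 0 le_rfl y
    have hf : Integrable f haarT := (Lp.memLp f).integrable (by norm_num)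
    calc ‖∫ x, φ.1 x * f x ∂haarT‖ ≤ ∫ x, ‖f x‖ * B ∂haarT := by
          refine norm_integral_le_of_norm_le (hf.norm.mul_const B)
            (Filter.Eventually.of_forall fun x => ?_)
          rw [norm_mul, mul_comm]
          exact mul_le_mul_of_nonneg_left (hB x) (norm_nonneg _)
      _ = (∫ x, ‖f x‖ ∂haarT) * B := integral_mul_const B _

/-! ### The Gaussian measure with inverse covariance `1 - Δ` -/

/-- `⟨n⟩ = (1 + (2πn)²)^{1/2}`, the square root of the eigenvalue of `1 - Δ` at `e^{2πinx}`. -/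
def bracket (n : ℤ) : ℝ := Real.sqrt (1 + (2 * Real.pi * n) ^ 2)

/-- The law of a family of independent standard Gaussian vectors in `ℝ²`, indexed by `ℤ`. -/
def whiteNoise : Measure (ℤ → ℝ × ℝ) :=
  Measure.infinitePi fun _ => (gaussianReal 0 1).prod (gaussianReal 0 1)

/-- The `n`-th Fourier coefficient `g_n / ⟨n⟩`, where `Re g_n` and `Im g_n` are the two
coordinates of `g n`. -/
def coeff (g : ℤ → ℝ × ℝ) (n : ℤ) : ℂ :=
  ((g n).1 + (g n).2 * Complex.I) / (bracket n : ℂ)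

/-- The random Fourier series `∑ₙ (g_n / ⟨n⟩) e^{2πinx}`, summed in `L²(𝕋)`
(where it converges almost surely). -/
def randomSeries (g : ℤ → ℝ × ℝ) : Lp ℂ 2 haarT :=
  ∑' n : ℤ, coeff g n • fourierLp 2 n

/-- The centred Gaussian measure `μ` on `𝒟'(𝕋)` with inverse covariance `1 - Δ`, formally
`dμ(u) = Z⁻¹ exp(-½ ∫|u|² - ½ ∫|∂ₓu|²) du`. As `½ ∫|u|² + ½ ∫|∂ₓu|² = ∑ₙ ½ ⟨n⟩² |û(n)|²`,
it is the law of the random Fourier series whose coefficients `û(n)` are independent, with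
independent real and imaginary parts of mean zero and variance `⟨n⟩⁻²`. -/
def gaussianMeasure : Measure TorusDistribution :=
  whiteNoise.map fun g => TorusDistribution.ofLp (randomSeries g)

/-- The weight `exp(β ∫_𝕋 |u|⁶ dx) 1_{M(u) ≤ K}`. -/
def gibbsWeight (β : ℝ) (K : ℝ≥0∞) : TorusDistribution → ℝ≥0∞ :=
  {u : TorusDistribution | u.mass ≤ K}.indicator
    fun u => EReal.exp ((β : EReal) * ((u.powInt 6 : ℝ≥0∞) : EReal))

/-! ### The measure is well defined -/

theorem measurable_coeff (n : ℤ) : Measurable fun g : ℤ → ℝ × ℝ => coeff g n := by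
  unfold coeff; fun_prop

theorem hasSum_pair (f : ℤ → Lp ℂ 2 haarT) (hf : Summable f) (φ : SmoothTorus) :
    HasSum (fun n => ∫ x, φ.1 x * f n x ∂haarT) (∫ x, φ.1 x * (∑' n, f n : Lp ℂ 2 haarT) x ∂haarT) := by
  have key : ∀ h : Lp ℂ 2 haarT, ∫ x, φ.1 x * h x ∂haarT
      = inner ℂ ((SmoothTorus.memLp φ).star.toLp _) h := by
    intro h
    rw [L2.inner_def]
    refine integral_congr_ae ?_
    filter_upwards [(SmoothTorus.memLp φ).star.coeFn_toLp] with x hx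
    rw [hx]; simp [mul_comm]
  simp_rw [key]
  exact (hf.hasSum).mapL (innerSL ℂ ((SmoothTorus.memLp φ).star.toLp _))

theorem summable_iff (c : ℤ → ℂ) : Summable (fun n => c n • (fourierLp 2 n : Lp ℂ 2 haarT)) ↔
    Summable fun n => ‖c n‖ ^ 2 := by
  have := (orthonormal_fourier (T := 1)).orthogonalFamily.summable_iff_norm_sq_summable (fun n => c n)
  simpa using this

/-- The random Fourier series is a random variable with values in `𝒟'(𝕋)`. -/
theorem measurable_series : Measurable fun g => TorusDistribution.ofLp (randomSeries g) := by
  refine Measurable.of_comap_le ?_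
  rw [instMeasurableSpaceTorusDistribution, MeasurableSpace.comap_iSup]
  refine iSup_le fun φ => ?_
  rw [MeasurableSpace.comap_comp, ← measurable_iff_comap_le]
  let S : Set (ℤ → ℝ × ℝ) := {g | Summable fun n => ‖coeff g n‖ ^ 2}
  have hS : MeasurableSet S := by
    have : S = {g | ∑' n, ENNReal.ofReal (‖coeff g n‖ ^ 2) < ⊤} := by
      ext g
      constructor
      · intro h; exact (Summable.tsum_ofReal_lt_top h)
      · intro h
        exact (ENNReal.summable_toReal h.ne).congr fun n => by simp
    rw [this]
    refine measurableSet_lt (Measurable.tsum fun n => ?_) measurable_const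
    exact ((measurable_coeff n).norm.pow_const 2).ennreal_ofReal
  have hlim : Measurable fun g : ℤ → ℝ × ℝ => S.indicator (fun g => ∫ x, φ.1 x * randomSeries g x ∂haarT) g := by
    refine measurable_of_tendsto_metrizable' (Filter.atTop : Filter (Finset ℤ))
      (f := fun s g => S.indicator (fun g => ∑ n ∈ s, coeff g n * ∫ x, φ.1 x * (fourierLp 2 n : Lp ℂ 2 haarT) x ∂haarT) g) ?_ ?_
    · intro s
      exact (Finset.measurable_fun_sum s fun n _ => (measurable_coeff n).mul_const _).indicator hS
    · rw [tendsto_pi_nhds]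
      intro g
      by_cases hg : g ∈ S
      · simp only [Set.indicator_of_mem hg]
        have h := hasSum_pair _ ((summable_iff (coeff g)).2 hg) φ
        have e : ∀ n, ∫ x, φ.1 x * (coeff g n • (fourierLp 2 n : Lp ℂ 2 haarT) : Lp ℂ 2 haarT) x ∂haarT
          = coeff g n * ∫ x, φ.1 x * (fourierLp 2 n : Lp ℂ 2 haarT) x ∂haarT := by
          intro n
          rw [← integral_const_mul]
          refine integral_congr_ae ?_
          filter_upwards [Lp.coeFn_smul (coeff g n) (fourierLp 2 n : Lp ℂ 2 haarT)] with x hx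
          rw [hx]; simp; ring
        simp_rw [e] at h
        exact h
      · simp [Set.indicator_of_notMem hg]
  convert hlim using 1
  funext g
  by_cases hg : g ∈ S
  · simp [Set.indicator_of_mem hg, TorusDistribution.ofLp]
  · have : randomSeries g = 0 := tsum_eq_zero_of_not_summable (mt (summable_iff _).1 hg)
    rw [Set.indicator_of_notMem hg]
    simp only [Function.comp, TorusDistribution.ofLp, this]
    show ∫ x, φ.1 x * (0 : Lp ℂ 2 haarT) x ∂haarT = 0
    rw [integral_eq_zero_of_ae]
    filter_upwards [Lp.coeFn_zero ℂ 2 haarT] with x hx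
    simp

instance instProbWhiteNoise : IsProbabilityMeasure whiteNoise := by unfold whiteNoise; infer_instance
instance instProbGaussian : IsProbabilityMeasure gaussianMeasure :=
  Measure.isProbabilityMeasure_map measurable_series.aemeasurable

theorem ae_summable : ∀ᵐ g ∂whiteNoise, Summable fun n => ‖coeff g n‖ ^ 2 := by
  have h2 : ∀ n, ∫⁻ g, ENNReal.ofReal (‖coeff g n‖ ^ 2) ∂whiteNoise
      = ENNReal.ofReal (2 / (1 + (2 * Real.pi * n) ^ 2)) := by
    intro n
    have hb : (bracket n) ^ 2 = 1 + (2 * Real.pi * n) ^ 2 := Real.sq_sqrt (by positivity)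
    have e : ∀ g : ℤ → ℝ × ℝ, ENNReal.ofReal (‖coeff g n‖ ^ 2)
       = (fun z : ℝ × ℝ => ENNReal.ofReal ((z.1 ^ 2 + z.2 ^ 2) / (1 + (2 * Real.pi * n) ^ 2))) (g n) := by
      intro g
      unfold coeff
      rw [norm_div, div_pow, ← Complex.normSq_eq_norm_sq, Complex.normSq_add_mul_I, Complex.norm_real, Real.norm_eq_abs, sq_abs, hb]
    simp_rw [e]
    have hI : ∀ i : Unit, Integrable (fun x : ℝ => x ^ 2) (gaussianReal 0 1) := fun _ =>
      (memLp_id_gaussianReal (μ := 0) (v := 1) 2).integrable_sq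
    have hv : ∫ x : ℝ, x ^ 2 ∂gaussianReal 0 1 = 1 := by
      have := variance_fun_id_gaussianReal (μ := 0) (v := 1)
      rw [variance_of_integral_eq_zero (X := fun x : ℝ => x) aemeasurable_id (by simp)] at this
      simpa using this
    have := (measurePreserving_eval_infinitePi (fun _ : ℤ => (gaussianReal 0 1).prod (gaussianReal 0 1)) n)
    unfold whiteNoise
    rw [this.lintegral_comp (f := fun z : ℝ × ℝ => ENNReal.ofReal ((z.1 ^ 2 + z.2 ^ 2) / (1 + (2 * Real.pi * n) ^ 2))) (by fun_prop)]
    have i1 : Integrable (fun z : ℝ × ℝ => z.1 ^ 2) ((gaussianReal 0 1).prod (gaussianReal 0 1)) := (hI ()).comp_fst _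
    have i2 : Integrable (fun z : ℝ × ℝ => z.2 ^ 2) ((gaussianReal 0 1).prod (gaussianReal 0 1)) := (hI ()).comp_snd _
    rw [← ofReal_integral_eq_lintegral_ofReal (f := fun z : ℝ × ℝ => (z.1 ^ 2 + z.2 ^ 2) / (1 + (2 * Real.pi * n) ^ 2)) ((i1.add i2).div_const _) (Filter.Eventually.of_forall fun z => by simp only [Pi.zero_apply]; positivity)]
    congr 1
    rw [integral_div, integral_add i1 i2, integral_fun_fst (fun x : ℝ => x^2), integral_fun_snd (fun x : ℝ => x ^2), hv]
    norm_num
  have h3 : ∫⁻ g, ∑' n, ENNReal.ofReal (‖coeff g n‖ ^ 2) ∂whiteNoise < ⊤ := by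
    rw [lintegral_tsum fun n => ((measurable_coeff n).norm.pow_const 2).ennreal_ofReal.aemeasurable]
    simp_rw [h2]
    refine Summable.tsum_ofReal_lt_top ?_
    have hs : Summable fun n : ℤ => (2 : ℝ) * (1 / (n:ℝ) ^ 2) := (Real.summable_one_div_int_pow.2 (by norm_num)).mul_left 2
    refine Summable.of_norm_bounded_eventually hs ?_
    filter_upwards [(Set.finite_singleton (0:ℤ)).compl_mem_cofinite] with n hn
    have hn' : (n : ℝ) ≠ 0 := by simpa using hn
    have : (0:ℝ) < (n:ℝ)^2 := by positivity
    rw [Real.norm_of_nonneg (by positivity), ← div_eq_mul_one_div]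
    refine div_le_div_of_nonneg_left (by norm_num) this ?_
    nlinarith [Real.pi_gt_three, mul_pos (sub_pos.2 Real.pi_gt_three) this, mul_pos (mul_pos Real.pi_pos Real.pi_pos) this, mul_pos Real.pi_pos this, mul_pos (mul_pos (sub_pos.2 Real.pi_gt_three) Real.pi_pos) this]
  have h4 : Measurable fun g : ℤ → ℝ × ℝ => ∑' n, ENNReal.ofReal (‖coeff g n‖ ^ 2) :=
    Measurable.tsum fun n => ((measurable_coeff n).norm.pow_const 2).ennreal_ofReal
  filter_upwards [ae_lt_top h4 h3.ne] with g hg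
  exact (ENNReal.summable_toReal hg.ne).congr fun n => by simp

/-- The random Fourier series converges in `L²(𝕋)` almost surely. -/
theorem ae_summable_series : ∀ᵐ g ∂whiteNoise,
    Summable fun n => coeff g n • (fourierLp 2 n : Lp ℂ 2 haarT) := by
  simp_rw [summable_iff]
  exact ae_summable

end TorusGibbs

end

/-! The normalisation of `Q` makes `(p/6)∫|Q|⁶ - ½∫|Q'|² = ((p-1)/2)∫|Q'|²`, which is positive for
`p > 1`. This strict inequality survives multiplying `Q` by some `a < 1` and cutting off far out.
The result is a compactly supported `w` with mass strictly below the threshold and `(p/6)∫|w|⁶ >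
½∫|w'|²` (`exists_isCompetitor`). The dilations `√l w(lx)` keep the mass and multiply both terms by
`l²`; for large `l` they fit into one period and so live on the torus.

Around such a profile `F` take an `L²` ball of radius `δ` independent of `l`. On it the mass
constraint still holds, because `w` has mass to spare. Also `∫|u|⁶ ≥ l² c₆`, because `∫|u|⁶` is
lower semicontinuous for `L²` convergence and dilation, an `L²` isometry, transfers the bound for
`w` to every scale (`exists_lt_lintegral_six_of_near_dil`). By Cameron-Martin and symmetry, the
measure of a ball centred at a trigonometric polynomial is at least `exp(-½‖·‖²_{H¹})` times that of
the centred ball (`exp_mul_smallBall_le`), and the latter is positive (`smallBall_pos`). Only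
finitely many modes are shifted: `F` is replaced by a Fourier partial sum, whose energy Bessel's
inequality controls.

Altogether the integral is at least `P₀ exp(κ l² - W)` with `κ, P₀ > 0` and `W` independent of `l`;
let `l → ∞`.

Measurability is a separate matter: almost every `u` is an `L²` function that depends measurably on
the Fourier coefficients of `u`, and `∫|·|^r` is lower semicontinuous, hence Borel, on `L²`. -/

namespace TorusGibbs

open Filter Topology Set

/-! ### Fourier uniqueness for integrable functions on the torus -/

theorem volume_eq_haarT : (volume : Measure UnitAddCircle) = haarT := by
  rw [AddCircle.volume_eq_smul_haarAddCircle]; simp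

/-- Integration against `f` is a bounded functional on `C(𝕋)` that vanishes on the exponentials,
whose span is dense. -/
theorem integral_continuous_mul_eq_zero {f : UnitAddCircle → ℂ} (hf : Integrable f haarT)
    (h : ∀ n, fourierCoeff f n = 0) (ψ : C(UnitAddCircle, ℂ)) :
    ∫ x, ψ x * f x ∂haarT = 0 := by
  have hint : ∀ ψ : C(UnitAddCircle, ℂ), Integrable (fun x => ψ x * f x) haarT := fun ψ =>
    hf.bdd_mul ψ.continuous.aestronglyMeasurable (c := ‖ψ‖)
      (Eventually.of_forall fun x => ψ.norm_coe_le_norm x)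
  let L : C(UnitAddCircle, ℂ) →L[ℂ] ℂ := LinearMap.mkContinuous
    { toFun := fun ψ => ∫ x, ψ x * f x ∂haarT
      map_add' := fun a b => by
        rw [← integral_add (hint a) (hint b)]
        simp [add_mul]
      map_smul' := fun c a => by
        simp only [ContinuousMap.coe_smul, Pi.smul_apply, smul_eq_mul, RingHom.id_apply, mul_assoc]
        exact integral_const_mul c _ } (∫ x, ‖f x‖ ∂haarT) (fun a => by
      rw [← integral_mul_const]
      refine norm_integral_le_of_norm_le (hf.norm.mul_const _) (Eventually.of_forall fun x => ?_)
      rw [norm_mul, mul_comm]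
      exact mul_le_mul_of_nonneg_left (a.norm_coe_le_norm x) (norm_nonneg _))
  have hL : L = 0 := by
    refine ContinuousLinearMap.ext_on (s := range (@fourier 1)) ?_ ?_
    · have := span_fourier_closure_eq_top (T := 1)
      rw [dense_iff_closure_eq, ← Submodule.topologicalClosure_coe, this]; rfl
    · rintro _ ⟨n, rfl⟩
      have := h (-n)
      simpa [fourierCoeff, L] using this
  exact DFunLike.congr_fun hL ψ

/-- Since `f` is merely integrable, Hilbert space completeness does not apply. Indicators of closed
sets are bounded pointwise limits of continuous functions, so the integral of `f` over every closed
set vanishes. -/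
theorem ae_eq_zero_of_fourierCoeff_eq_zero {f : UnitAddCircle → ℂ} (hf : Integrable f haarT)
    (h : ∀ n, fourierCoeff f n = 0) : f =ᵐ[haarT] 0 := by
  refine ae_eq_zero_of_forall_setIntegral_isClosed_eq_zero hf fun s hs => ?_
  rw [← integral_indicator hs.measurableSet]
  refine tendsto_nhds_unique (f := fun n : ℕ => ∫ x, ((hs.apprSeq n x : ℝ) : ℂ) * f x ∂haarT)
    (l := atTop) ?_ ?_
  · refine tendsto_integral_of_dominated_convergence (fun x => ‖f x‖) (fun n => ?_) hf.norm
      (fun n => Eventually.of_forall fun x => ?_) (Eventually.of_forall fun x => ?_)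
    · refine AEStronglyMeasurable.mul (Continuous.aestronglyMeasurable ?_) hf.aestronglyMeasurable
      exact Complex.continuous_ofReal.comp
        (NNReal.continuous_coe.comp (hs.apprSeq n).continuous)
    · rw [norm_mul, Complex.norm_real, Real.norm_of_nonneg (NNReal.coe_nonneg _)]
      refine mul_le_of_le_one_left (norm_nonneg _) ?_
      exact_mod_cast HasOuterApproxClosed.apprSeq_apply_le_one hs n x
    · have h1 := tendsto_pi_nhds.1 (HasOuterApproxClosed.tendsto_apprSeq hs) x
      have h2 : Tendsto (fun n => ((hs.apprSeq n x : ℝ) : ℂ) * f x) atTop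
          (𝓝 ((((s.indicator (fun _ => (1 : NNReal)) x : NNReal) : ℝ) : ℂ) * f x)) :=
        ((Complex.continuous_ofReal.tendsto _).comp
          ((NNReal.continuous_coe.tendsto _).comp h1)).mul_const _
      convert h2 using 2
      by_cases hx : x ∈ s <;> simp [hx]
  · have : ∀ n : ℕ, ∫ x, ((hs.apprSeq n x : ℝ) : ℂ) * f x ∂haarT = 0 := fun n =>
      integral_continuous_mul_eq_zero hf h ⟨fun x => ((hs.apprSeq n x : ℝ) : ℂ),
        Complex.continuous_ofReal.comp (NNReal.continuous_coe.comp (hs.apprSeq n).continuous)⟩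
    simp [this]

/-! ### Smooth functions and their Fourier series -/

theorem contDiff_fourier (n : ℤ) : ContDiff ℝ ∞ fun x : ℝ => fourier n (x : UnitAddCircle) := by
  simp_rw [fourier_coe_apply]
  have : ContDiff ℝ ∞ fun x : ℝ => (x : ℂ) := Complex.ofRealCLM.contDiff
  exact ((contDiff_const.mul this).div_const _).cexp

/-- The exponential `e^{2πinx}` as a test function. -/
noncomputable def fourierSmooth (n : ℤ) : SmoothTorus := ⟨fourier n, contDiff_fourier n⟩

theorem coe_fourierSmooth (n : ℤ) : (fourierSmooth n).1 = fourier n := rfl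

namespace SmoothTorus

/-- A smooth function on the torus, read on the real line. -/
def lift (φ : SmoothTorus) (x : ℝ) : ℂ := φ.1 (x : UnitAddCircle)

theorem contDiff_lift (φ : SmoothTorus) : ContDiff ℝ ∞ (lift φ) := φ.2

theorem periodic_deriv_lift (φ : SmoothTorus) : Function.Periodic (deriv (lift φ)) 1 := by
  intro x
  rw [← deriv_comp_add_const]
  congr 1
  ext y
  simp [lift]

/-- The derivative on `C^∞(𝕋)`. -/
noncomputable def D : SmoothTorus →ₗ[ℂ] SmoothTorus where
  toFun φ := ⟨(periodic_deriv_lift φ).lift, by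
    have h : ContDiff ℝ ∞ (deriv (lift φ)) := (contDiff_infty_iff_deriv.1 (contDiff_lift φ)).2
    exact h⟩
  map_add' a b := by
    ext x
    obtain ⟨y, rfl⟩ := QuotientAddGroup.mk_surjective x
    exact deriv_add ((contDiff_lift a).differentiable (by simp) y)
      ((contDiff_lift b).differentiable (by simp) y)
  map_smul' c a := by
    ext x
    obtain ⟨y, rfl⟩ := QuotientAddGroup.mk_surjective x
    exact deriv_const_mul c ((contDiff_lift a).differentiable (by simp) y)

theorem lift_D (φ : SmoothTorus) : lift (D φ) = deriv (lift φ) := rfl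

theorem hasDerivAt_lift (φ : SmoothTorus) (x : ℝ) : HasDerivAt (lift φ) (lift (D φ) x) x :=
  ((contDiff_lift φ).differentiable (by simp) x).hasDerivAt

theorem iteratedDeriv_lift (φ : SmoothTorus) (k : ℕ) :
    iteratedDeriv k (lift φ) = lift ((D ^ k) φ) := by
  induction k with
  | zero => simp
  | succ k ih => rw [iteratedDeriv_succ, ih, ← lift_D, pow_succ']; rfl

theorem D_fourierSmooth (n : ℤ) : D (fourierSmooth n) = (2 * Real.pi * Complex.I * n) •
    fourierSmooth n := by
  ext x
  obtain ⟨y, rfl⟩ := QuotientAddGroup.mk_surjective x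
  have := (hasDerivAt_fourier 1 n y).deriv
  simp only [Complex.ofReal_one, div_one] at this
  exact this

theorem fourierCoeff_D (φ : SmoothTorus) (n : ℤ) :
    fourierCoeff (D φ).1 n = (2 * Real.pi * Complex.I * n) * fourierCoeff φ.1 n := by
  have hc : ∀ ψ : SmoothTorus, Continuous (lift ψ) := fun ψ => (contDiff_lift ψ).continuous
  rw [fourierCoeff_eq_intervalIntegral _ n 0, fourierCoeff_eq_intervalIntegral _ n 0]
  have := intervalIntegral.integral_mul_deriv_eq_deriv_mul (a := 0) (b := 1)
    (u := lift (fourierSmooth (-n))) (v := lift φ) (u' := lift (D (fourierSmooth (-n))))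
    (v' := lift (D φ)) (fun x _ => hasDerivAt_lift _ x) (fun x _ => hasDerivAt_lift _ x)
    ((hc _).intervalIntegrable _ _) ((hc _).intervalIntegrable _ _)
  have e0 : ∀ ψ : SmoothTorus, lift ψ 1 = lift ψ 0 := fun ψ => by
    simpa [lift] using congrArg ψ.1 (AddCircle.coe_period (1 : ℝ))
  rw [e0, e0, sub_self, zero_sub, D_fourierSmooth] at this
  simp only [zero_add, one_div, inv_one, one_smul, smul_eq_mul]
  refine this.trans ?_
  rw [← intervalIntegral.integral_const_mul, ← intervalIntegral.integral_neg]
  refine intervalIntegral.integral_congr fun x _ => ?_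
  simp only [lift, Submodule.coe_smul, Pi.smul_apply, smul_eq_mul, coe_fourierSmooth]
  push_cast
  ring

theorem fourierCoeff_D_pow (φ : SmoothTorus) (k : ℕ) (n : ℤ) :
    fourierCoeff ((D ^ k) φ).1 n = (2 * Real.pi * Complex.I * n) ^ k * fourierCoeff φ.1 n := by
  induction k with
  | zero => simp
  | succ k ih =>
    rw [pow_succ', Module.End.mul_apply, fourierCoeff_D, ih]; ring

/-- A smooth function as an element of `C(𝕋)`. -/
def toC (φ : SmoothTorus) : C(UnitAddCircle, ℂ) := ⟨φ.1, SmoothTorus.continuous φ⟩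

theorem norm_fourierCoeff_le (φ : SmoothTorus) (n : ℤ) : ‖fourierCoeff φ.1 n‖ ≤ ‖toC φ‖ := by
  unfold fourierCoeff
  refine (norm_integral_le_of_norm_le_const (C := ‖toC φ‖)
    (Eventually.of_forall fun x => ?_)).trans (by simp)
  rw [norm_smul]
  have h1 : ‖fourier (-n) x‖ = 1 := by rw [fourier_apply]; exact Circle.norm_coe _
  rw [h1, one_mul]
  exact (toC φ).norm_coe_le_norm x

/-- Two derivatives cost a factor `(2πn)²`, and the coefficients of the second derivative are
bounded. -/
theorem summable_fourierCoeff (φ : SmoothTorus) : Summable (fourierCoeff φ.1) := by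
  have hs : Summable fun n : ℤ => ‖toC ((D ^ 2) φ)‖ * (1 / (n : ℝ) ^ 2) :=
    (Real.summable_one_div_int_pow.2 (by norm_num)).mul_left _
  refine Summable.of_norm_bounded_eventually hs ?_
  filter_upwards [(finite_singleton (0 : ℤ)).compl_mem_cofinite] with n hn
  have hn' : (n : ℝ) ≠ 0 := by simpa using hn
  have h0 : (0 : ℝ) < (n : ℝ) ^ 2 := by positivity
  have h := norm_fourierCoeff_le ((D ^ 2) φ) n
  rw [fourierCoeff_D_pow, norm_mul, norm_pow] at h
  have h3 : ‖(2 * Real.pi * Complex.I * n : ℂ)‖ = 2 * Real.pi * |(n : ℝ)| := by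
    simp [abs_of_pos Real.pi_pos]
  rw [h3, mul_pow, sq_abs] at h
  rw [mul_one_div, le_div_iff₀ h0]
  refine le_trans ?_ h
  have : (1 : ℝ) ≤ (2 * Real.pi) ^ 2 := by nlinarith [Real.pi_gt_three]
  nlinarith [mul_nonneg (norm_nonneg (fourierCoeff φ.1 n)) h0.le]

/-- The partial sums of the Fourier series. -/
noncomputable def partialSum (φ : SmoothTorus) (s : Finset ℤ) : SmoothTorus :=
  ∑ n ∈ s, fourierCoeff φ.1 n • fourierSmooth n

theorem D_pow_fourierSmooth (k : ℕ) (n : ℤ) : (D ^ k) (fourierSmooth n) =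
    (2 * Real.pi * Complex.I * n) ^ k • fourierSmooth n := by
  induction k with
  | zero => simp
  | succ k ih =>
    rw [pow_succ', Module.End.mul_apply, ih, map_smul, D_fourierSmooth, smul_smul, ← pow_succ]

/-- Differentiation commutes with partial sums, so uniform convergence, applied to each derivative,
becomes convergence in every `C^N`. -/
theorem D_pow_partialSum (φ : SmoothTorus) (k : ℕ) (s : Finset ℤ) :
    (D ^ k) (partialSum φ s) = partialSum ((D ^ k) φ) s := by
  simp only [partialSum, map_sum, map_smul, D_pow_fourierSmooth, fourierCoeff_D_pow, smul_smul,
    mul_comm]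

theorem toC_partialSum (φ : SmoothTorus) (s : Finset ℤ) :
    toC (partialSum φ s) = ∑ n ∈ s, fourierCoeff φ.1 n • fourier n := by
  ext x
  simp [toC, partialSum, coe_fourierSmooth]

theorem tendsto_norm_toC_partialSum (φ : SmoothTorus) :
    Tendsto (fun s => ‖toC (φ - partialSum φ s)‖) atTop (𝓝 0) := by
  have h : HasSum (fun i => fourierCoeff φ.1 i • fourier i) (toC φ) :=
    hasSum_fourier_series_of_summable (f := toC φ) (summable_fourierCoeff φ)
  have h2 := (tendsto_const_nhds (x := toC φ)).sub (h : Tendsto _ _ _)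
  rw [sub_self] at h2
  refine (tendsto_zero_iff_norm_tendsto_zero.1 h2).congr fun s => ?_
  rw [← toC_partialSum]
  rfl

end SmoothTorus

/-! ### Distributions, their Fourier coefficients and representing functions -/

namespace TorusDistribution

/-- The Fourier series of `φ` converges in the `C^N` norm that bounds `u`. -/
theorem hasSum_fourierCoeff_mul (u : TorusDistribution) (φ : SmoothTorus) :
    HasSum (fun n => fourierCoeff φ.1 n * u.toLin (fourierSmooth n)) (u.toLin φ) := by
  obtain ⟨N, C, hC⟩ := u.bound
  have hle : ∀ s : Finset ℤ, ‖u.toLin φ - u.toLin (SmoothTorus.partialSum φ s)‖ ≤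
      C * ∑ k ∈ Finset.range (N + 1),
        ‖SmoothTorus.toC ((SmoothTorus.D ^ k) φ - SmoothTorus.partialSum ((SmoothTorus.D ^ k) φ) s)‖ := by
    intro s
    rw [← map_sub]
    refine hC _ _ fun k hk x => ?_
    refine le_trans ?_ (Finset.single_le_sum (f := fun k =>
      ‖SmoothTorus.toC ((SmoothTorus.D ^ k) φ - SmoothTorus.partialSum ((SmoothTorus.D ^ k) φ) s)‖)
      (fun _ _ => norm_nonneg _) (Finset.mem_range.2 (Nat.lt_succ_of_le hk)))
    have e := congrFun (SmoothTorus.iteratedDeriv_lift (φ - SmoothTorus.partialSum φ s) k) x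
    rw [map_sub, SmoothTorus.D_pow_partialSum] at e
    exact (congrArg norm e).trans_le
      ((SmoothTorus.toC ((SmoothTorus.D ^ k) φ - SmoothTorus.partialSum
        ((SmoothTorus.D ^ k) φ) s)).norm_coe_le_norm _)
  have ht : Tendsto (fun s : Finset ℤ => C * ∑ k ∈ Finset.range (N + 1),
        ‖SmoothTorus.toC ((SmoothTorus.D ^ k) φ - SmoothTorus.partialSum ((SmoothTorus.D ^ k) φ) s)‖)
      atTop (𝓝 0) := by
    have := (tendsto_finsetSum (Finset.range (N + 1)) fun k _ =>
      SmoothTorus.tendsto_norm_toC_partialSum ((SmoothTorus.D ^ k) φ)).const_mul C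
    simpa using this
  have h0 := squeeze_zero_norm hle ht
  have h1 := (tendsto_const_nhds (x := u.toLin φ)).sub h0
  simp only [sub_sub_cancel, sub_zero] at h1
  refine Tendsto.congr (fun s => ?_) h1
  simp [SmoothTorus.partialSum]

theorem ext_fourier {u v : TorusDistribution}
    (h : ∀ n, u.toLin (fourierSmooth n) = v.toLin (fourierSmooth n)) : u = v := by
  have : u.toLin = v.toLin := by
    ext φ
    refine (hasSum_fourierCoeff_mul u φ).unique ?_
    simp_rw [h]
    exact hasSum_fourierCoeff_mul v φ
  cases u; cases v; congr

theorem isFunction_ofLp (f : Lp ℂ 2 haarT) : (ofLp f).IsFunction f :=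
  ⟨(Lp.memLp f).integrable (by norm_num), fun _ => rfl⟩

/-- Makes the infimum defining `powInt` an infimum over equal values. -/
theorem IsFunction.ae_eq {u : TorusDistribution} {f g : UnitAddCircle → ℂ}
    (hf : u.IsFunction f) (hg : u.IsFunction g) : f =ᵐ[haarT] g := by
  have h : f - g =ᵐ[haarT] 0 := by
    refine ae_eq_zero_of_fourierCoeff_eq_zero (hf.1.sub hg.1) fun n => ?_
    have h1 := hf.2 (fourierSmooth (-n))
    rw [hg.2, coe_fourierSmooth] at h1
    have hb : ∀ {k : UnitAddCircle → ℂ}, Integrable k haarT →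
        Integrable (fun x => fourier (-n) x * k x) haarT := fun hk => hk.fourier_smul (-n)
    simp only [fourierCoeff, Pi.sub_apply, mul_sub, smul_eq_mul]
    rw [integral_sub (hb hf.1) (hb hg.1), h1, sub_self]
  filter_upwards [h] with x hx
  simpa [sub_eq_zero] using hx

theorem powInt_eq {u : TorusDistribution} {f : UnitAddCircle → ℂ} (hf : u.IsFunction f) (r : ℝ) :
    u.powInt r = ∫⁻ x, ‖f x‖ₑ ^ r ∂haarT := by
  refine le_antisymm (iInf₂_le f hf) (le_iInf₂ fun g hg => le_of_eq ?_)
  refine lintegral_congr_ae ?_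
  filter_upwards [hf.ae_eq hg] with x hx
  rw [hx]

theorem powInt_ofLp (f : Lp ℂ 2 haarT) (r : ℝ) :
    (ofLp f).powInt r = ∫⁻ x, ‖f x‖ₑ ^ r ∂haarT := powInt_eq (isFunction_ofLp f) r

end TorusDistribution

/-! ### Lower semicontinuity of `∫ |u|^r` for convergence in `L²` -/

section LowerSemicontinuity

variable {α : Type*} [MeasurableSpace α] {m : Measure α}

/-- An a.e. convergent subsequence and Fatou's lemma. -/
theorem lintegral_rpow_le_of_tendsto_eLpNorm {r : ℝ} {u : ℕ → α → ℂ} {w : α → ℂ}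
    (hu : ∀ n, AEStronglyMeasurable (u n) m) (hw : AEStronglyMeasurable w m)
    (h : Tendsto (fun n => eLpNorm (u n - w) 2 m) atTop (𝓝 0)) {c : ℝ≥0∞}
    (hc : ∀ n, ∫⁻ x, ‖u n x‖ₑ ^ r ∂m ≤ c) : ∫⁻ x, ‖w x‖ₑ ^ r ∂m ≤ c := by
  obtain ⟨ns, -, hns⟩ := (tendstoInMeasure_of_tendsto_eLpNorm (by norm_num : (2 : ℝ≥0∞) ≠ 0) hu hw
    h).exists_seq_tendsto_ae
  have hlim : ∀ᵐ x ∂m, Tendsto (fun n => ‖u (ns n) x‖ₑ ^ r) atTop (𝓝 (‖w x‖ₑ ^ r)) := by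
    filter_upwards [hns] with x hx
    exact ((ENNReal.continuous_rpow_const.tendsto _).comp hx.enorm)
  calc ∫⁻ x, ‖w x‖ₑ ^ r ∂m = ∫⁻ x, liminf (fun n => ‖u (ns n) x‖ₑ ^ r) atTop ∂m :=
        lintegral_congr_ae (by filter_upwards [hlim] with x hx using hx.liminf_eq.symm)
    _ ≤ liminf (fun n => ∫⁻ x, ‖u (ns n) x‖ₑ ^ r ∂m) atTop :=
        lintegral_liminf_le' fun n => (hu _).enorm.pow_const r
    _ ≤ c := liminf_le_of_le (by isBoundedDefault) fun b hb => by
        obtain ⟨n, hn⟩ := hb.exists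
        exact hn.trans (hc _)

theorem exists_eLpNorm_sub_le_imp_lt_lintegral_rpow {r : ℝ} {w : α → ℂ}
    (hw : AEStronglyMeasurable w m) {c : ℝ≥0∞} (hc : c < ∫⁻ x, ‖w x‖ₑ ^ r ∂m) :
    ∃ δ : ℝ, 0 < δ ∧ ∀ u : α → ℂ, AEStronglyMeasurable u m →
      eLpNorm (u - w) 2 m ≤ ENNReal.ofReal δ → c < ∫⁻ x, ‖u x‖ₑ ^ r ∂m := by
  by_contra! hcon
  choose! u hu1 hu2 hu3 using hcon
  have hpos : ∀ n : ℕ, (0 : ℝ) < 1 / ((n : ℝ) + 1) := fun n => Nat.one_div_pos_of_nat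
  refine absurd (lintegral_rpow_le_of_tendsto_eLpNorm
    (u := fun n : ℕ => u (1 / ((n : ℝ) + 1))) (fun n => hu1 _ (hpos n)) hw ?_
    (fun n => hu3 _ (hpos n))) hc.not_ge
  refine tendsto_of_tendsto_of_tendsto_of_le_of_le tendsto_const_nhds ?_ (fun _ => zero_le)
    (fun n => hu2 _ (hpos n))
  have := ENNReal.tendsto_ofReal (tendsto_one_div_add_atTop_nhds_zero_nat (𝕜 := ℝ))
  simpa using this

theorem lowerSemicontinuous_lintegral_rpow {r : ℝ} :
    LowerSemicontinuous fun f : Lp ℂ 2 m => ∫⁻ x, ‖f x‖ₑ ^ r ∂m := by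
  refine lowerSemicontinuous_iff_isClosed_preimage.2 fun c => ?_
  refine IsSeqClosed.isClosed fun u f hu hf => ?_
  refine lintegral_rpow_le_of_tendsto_eLpNorm (u := fun n => u n)
    (fun n => Lp.aestronglyMeasurable _) (Lp.aestronglyMeasurable _) ?_ hu
  exact (Lp.tendsto_Lp_iff_tendsto_eLpNorm' _ _).1 hf

end LowerSemicontinuity

/-! ### Measurability of the Gibbs weight -/

/-- Square summability of the coefficients is a measurable condition. Cutting the partial sums off
outside it makes them converge everywhere, in agreement with the value `0` of a divergent `tsum`. -/
theorem stronglyMeasurable_tsum_fourierLp {α : Type*} [MeasurableSpace α] {c : α → ℤ → ℂ}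
    (hc : ∀ n, Measurable fun a => c a n) :
    StronglyMeasurable fun a => (∑' n, c a n • fourierLp 2 n : Lp ℂ 2 haarT) := by
  let S : Set α := {a | Summable fun n => ‖c a n‖ ^ 2}
  have hS : MeasurableSet S := by
    have : S = {a | ∑' n, ENNReal.ofReal (‖c a n‖ ^ 2) < ⊤} := by
      ext a
      exact ⟨fun h => h.tsum_ofReal_lt_top,
        fun h => (ENNReal.summable_toReal h.ne).congr fun n => by simp⟩
    rw [this]
    exact measurableSet_lt (Measurable.tsum fun n => ((hc n).norm.pow_const 2).ennreal_ofReal)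
      measurable_const
  have hmem : ∀ a, a ∈ S ↔ Summable fun n => c a n • (fourierLp 2 n : Lp ℂ 2 haarT) :=
    fun a => (summable_iff (c a)).symm
  refine stronglyMeasurable_of_tendsto (atTop : Filter (Finset ℤ))
    (f := fun s => S.indicator fun a => ∑ n ∈ s, c a n • (fourierLp 2 n : Lp ℂ 2 haarT))
    (fun s => ?_) (tendsto_pi_nhds.2 fun a => ?_)
  · exact (Finset.stronglyMeasurable_fun_sum s fun n _ =>
      (hc n).stronglyMeasurable.smul_const _).indicator hS
  · by_cases ha : a ∈ S
    · simp only [indicator_of_mem ha]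
      exact ((hmem a).1 ha).hasSum
    · simp only [indicator_of_notMem ha]
      rw [tsum_eq_zero_of_not_summable (mt (hmem a).2 ha)]
      exact tendsto_const_nhds

theorem measurable_lintegral_rpow_comp {α : Type*} [MeasurableSpace α] {F : α → Lp ℂ 2 haarT}
    (hF : StronglyMeasurable F) (r : ℝ) :
    Measurable fun a => ∫⁻ x, ‖F a x‖ₑ ^ r ∂haarT := by
  let _ : MeasurableSpace (Lp ℂ 2 haarT) := borel _
  have _ : BorelSpace (Lp ℂ 2 haarT) := ⟨rfl⟩
  exact lowerSemicontinuous_lintegral_rpow.measurable.comp hF.measurable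

theorem fourierCoeff_tsum {c : ℤ → ℂ} (hc : Summable fun n => ‖c n‖ ^ 2) (n : ℤ) :
    fourierCoeff (∑' n, c n • fourierLp 2 n : Lp ℂ 2 haarT) n = c n := by
  have hs := (summable_iff c).2 hc
  rw [← fourierBasis_repr, HilbertBasis.repr_apply_apply, coe_fourierBasis]
  have h := hs.hasSum.mapL (innerSL ℂ (fourierLp 2 n : Lp ℂ 2 haarT))
  refine h.unique ?_
  refine (hasSum_ite_eq n (c n)).congr_fun fun k => ?_
  rw [innerSL_apply_apply, inner_smul_right, orthonormal_iff_ite.1 orthonormal_fourier n k]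
  by_cases h : k = n
  · simp [h]
  · simp [h, Ne.symm h]

theorem summable_sq_fourierCoeff (f : Lp ℂ 2 haarT) : Summable fun n => ‖fourierCoeff f n‖ ^ 2 :=
  (hasSum_sq_fourierCoeff f).summable

namespace TorusDistribution

/-- The square integrable function with the Fourier coefficients of `u`, if there is one. -/
noncomputable def toLp (u : TorusDistribution) : Lp ℂ 2 haarT :=
  ∑' n, u.toLin (fourierSmooth (-n)) • fourierLp 2 n

theorem measurable_toLin (φ : SmoothTorus) :
    Measurable fun u : TorusDistribution => u.toLin φ :=
  Measurable.of_comap_le (le_iSup (fun φ : SmoothTorus =>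
    MeasurableSpace.comap (fun u : TorusDistribution => u.toLin φ) inferInstance) φ)

theorem stronglyMeasurable_toLp : StronglyMeasurable toLp :=
  stronglyMeasurable_tsum_fourierLp fun _ => measurable_toLin _

/-- The pairing is bilinear, so the `n`-th coefficient is read off with `e^{-2πinx}`. -/
theorem ofLp_fourierSmooth (f : Lp ℂ 2 haarT) (n : ℤ) :
    (ofLp f).toLin (fourierSmooth (-n)) = fourierCoeff f n := rfl

theorem ofLp_toLp {u : TorusDistribution}
    (hu : Summable fun n => ‖u.toLin (fourierSmooth (-n))‖ ^ 2) : ofLp u.toLp = u := by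
  refine ext_fourier fun n => ?_
  have := ofLp_fourierSmooth u.toLp (-n)
  rw [neg_neg] at this
  rw [this, toLp, fourierCoeff_tsum hu, neg_neg]

/-- Square summability of the coefficients is a cylindrical event, and it contains every
distribution given by an `L²` function. -/
theorem ae_ofLp_toLp : ∀ᵐ u ∂gaussianMeasure, ofLp u.toLp = u := by
  have hmeas : MeasurableSet {u : TorusDistribution |
      ∑' n, ENNReal.ofReal (‖u.toLin (fourierSmooth (-n))‖ ^ 2) < ⊤} :=
    measurableSet_lt (Measurable.tsum fun n =>
      ((measurable_toLin _).norm.pow_const 2).ennreal_ofReal) measurable_const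
  have h : ∀ᵐ u ∂gaussianMeasure,
      ∑' n, ENNReal.ofReal (‖u.toLin (fourierSmooth (-n))‖ ^ 2) < ⊤ := by
    refine (ae_map_iff measurable_series.aemeasurable hmeas).2 (Eventually.of_forall fun g => ?_)
    exact (summable_sq_fourierCoeff (randomSeries g)).tsum_ofReal_lt_top
  filter_upwards [h] with u hu
  exact ofLp_toLp ((ENNReal.summable_toReal hu.ne).congr fun n => by simp)

end TorusDistribution

theorem monotone_exp_mul {β : ℝ} (hβ : 0 ≤ β) :
    Monotone fun x : ℝ≥0∞ => EReal.exp ((β : EReal) * (x : EReal)) := fun _ _ hxy =>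
  EReal.exp_monotone (mul_le_mul_of_nonneg_left (EReal.coe_ennreal_le_coe_ennreal_iff.2 hxy)
    (EReal.coe_nonneg.2 hβ))

theorem gibbsWeight_ofLp (β : ℝ) (K : ℝ≥0∞) (f : Lp ℂ 2 haarT) :
    gibbsWeight β K (TorusDistribution.ofLp f) =
      {f : Lp ℂ 2 haarT | ∫⁻ x, ‖f x‖ₑ ^ (2 : ℝ) ∂haarT ≤ K}.indicator
        (fun f => EReal.exp ((β : EReal) * ((∫⁻ x, ‖f x‖ₑ ^ (6 : ℝ) ∂haarT : ℝ≥0∞) : EReal))) f := by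
  simp only [gibbsWeight, indicator, mem_ofPred_eq, TorusDistribution.mass,
    TorusDistribution.powInt_ofLp]

theorem aemeasurable_gibbsWeight {β : ℝ} (hβ : 0 ≤ β) (K : ℝ≥0∞) :
    AEMeasurable (gibbsWeight β K) gaussianMeasure := by
  refine ⟨fun u => gibbsWeight β K (TorusDistribution.ofLp u.toLp), ?_, ?_⟩
  · simp_rw [gibbsWeight_ofLp]
    have h2 := measurable_lintegral_rpow_comp TorusDistribution.stronglyMeasurable_toLp
      2
    have h6 := measurable_lintegral_rpow_comp TorusDistribution.stronglyMeasurable_toLp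
      6
    exact ((monotone_exp_mul hβ).measurable.comp h6).indicator
      (measurableSet_le h2 measurable_const)
  · filter_upwards [TorusDistribution.ae_ofLp_toLp] with u hu
    rw [hu]

theorem gibbsWeight_rpow {β p : ℝ} (hp : 0 < p) (K : ℝ≥0∞) (u : TorusDistribution) :
    gibbsWeight β K u ^ p = gibbsWeight (p * β) K u := by
  unfold gibbsWeight
  by_cases hu : u ∈ {u : TorusDistribution | u.mass ≤ K}
  · rw [indicator_of_mem hu, indicator_of_mem hu, ← EReal.exp_mul]
    congr 1
    rw [mul_comm, ← mul_assoc, ← EReal.coe_mul]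
  · rw [indicator_of_notMem hu, indicator_of_notMem hu, ENNReal.zero_rpow_of_pos hp]

/-! ### Densities for infinite products of probability measures -/

/-- A product measure is determined on finite boxes, where independence factors the integral of the
density. -/
theorem infinitePi_withDensity {ι : Type*} {E : ι → Type*} [∀ i, MeasurableSpace (E i)]
    (P : ∀ i, Measure (E i)) [∀ i, IsProbabilityMeasure (P i)] {ρ : ∀ i, E i → ℝ≥0∞}
    (hρ : ∀ i, Measurable (ρ i)) [∀ i, IsProbabilityMeasure ((P i).withDensity (ρ i))]
    (S : Finset ι) (hS : ∀ i ∉ S, ρ i = 1) :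
    Measure.infinitePi (fun i => (P i).withDensity (ρ i)) =
      (Measure.infinitePi P).withDensity fun g => ∏ i ∈ S, ρ i (g i) := by
  classical
  refine (Measure.eq_infinitePi _ fun t A hA => ?_).symm
  have hbox : MeasurableSet (Set.pi (t : Set ι) A) :=
    MeasurableSet.pi t.countable_toSet fun i _ => hA i
  let B : ∀ i, Set (E i) := fun i => if i ∈ t then A i else univ
  have hB : ∀ i, MeasurableSet (B i) := fun i => by
    by_cases hi : i ∈ t <;> simp [B, hi, hA]
  rw [withDensity_apply _ hbox, ← lintegral_indicator hbox]
  -- Box and density become one product over `S ∪ t`: `ρ i = 1` off `S`, and `B i` is everything off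
  -- `t`.
  have e : ∀ g : ∀ i, E i, (Set.pi (t : Set ι) A).indicator (fun g => ∏ i ∈ S, ρ i (g i)) g =
      ∏ i ∈ S ∪ t, (B i).indicator (ρ i) (g i) := by
    intro g
    by_cases hg : g ∈ Set.pi (t : Set ι) A
    · rw [indicator_of_mem hg, ← Finset.prod_subset Finset.subset_union_left]
      · refine Finset.prod_congr rfl fun i _ => ?_
        rw [indicator_of_mem]
        by_cases hi : i ∈ t
        · simpa [B, hi] using hg i hi
        · simp [B, hi]
      · intro i hi hiS
        have hit : i ∈ t := (Finset.mem_union.1 hi).resolve_left hiS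
        rw [indicator_of_mem, hS i hiS]
        · rfl
        · simpa [B, hit] using hg i hit
    · rw [indicator_of_notMem hg]
      simp only [Set.mem_pi, not_forall] at hg
      obtain ⟨i, hi, hig⟩ := hg
      refine (Finset.prod_eq_zero (Finset.mem_union_right _ (Finset.mem_coe.1 hi)) ?_).symm
      rw [indicator_of_notMem]
      simpa [B, Finset.mem_coe.1 hi] using hig
  simp_rw [e]
  have hX : ∀ i, Measurable ((B i).indicator (ρ i)) := fun i => (hρ i).indicator (hB i)
  have hprod := lintegral_prod_eq_prod_lintegral_of_indepFun (S ∪ t)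
    (fun i (g : ∀ i, E i) => (B i).indicator (ρ i) (g i)) (iIndepFun_infinitePi (P := P) hX)
    fun i => (hX i).comp (measurable_pi_apply i)
  rw [hprod]
  have hi : ∀ i, ∫⁻ g, (B i).indicator (ρ i) (g i) ∂(Measure.infinitePi P) =
      (P i).withDensity (ρ i) (B i) := fun i => by
    rw [(measurePreserving_eval_infinitePi P i).lintegral_comp (hX i),
      lintegral_indicator (hB i), withDensity_apply _ (hB i)]
  simp_rw [hi]
  rw [← Finset.prod_subset (Finset.subset_union_right (s₁ := S) (s₂ := t))]
  · exact Finset.prod_congr rfl fun i hi => by simp [B, hi]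
  -- Coordinates of `S` that the box leaves free contribute total mass one.
  · intro i _ hit
    simp only [B, hit, if_false, measure_univ]

/-! ### The Cameron-Martin formula for the white noise -/

theorem gaussianReal_map_add_eq_withDensity (y : ℝ) :
    (gaussianReal 0 1).map (· + y) =
      (gaussianReal 0 1).withDensity fun x => ENNReal.ofReal (Real.exp (y * x - y ^ 2 / 2)) := by
  rw [gaussianReal_map_add_const, gaussianReal_of_var_ne_zero _ one_ne_zero,
    gaussianReal_of_var_ne_zero _ one_ne_zero, ← withDensity_mul _ (measurable_gaussianPDF _ _)
      (by fun_prop)]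
  congr 1
  ext x
  simp only [gaussianPDF, gaussianPDFReal, Pi.mul_apply]
  rw [← ENNReal.ofReal_mul (by positivity), mul_assoc (√_)⁻¹, ← Real.exp_add]
  congr 3
  push_cast
  ring

/-- The standard Gaussian measure on `ℝ²`. -/
noncomputable abbrev stdGaussianPair : Measure (ℝ × ℝ) := (gaussianReal 0 1).prod (gaussianReal 0 1)

/-- The density of the translate of the standard Gaussian measure on `ℝ²` by `s`. -/
noncomputable def shiftDensity (s z : ℝ × ℝ) : ℝ≥0∞ :=
  ENNReal.ofReal (Real.exp (s.1 * z.1 + s.2 * z.2 - (s.1 ^ 2 + s.2 ^ 2) / 2))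

theorem measurable_shiftDensity (s : ℝ × ℝ) : Measurable (shiftDensity s) := by
  unfold shiftDensity; fun_prop

theorem map_add_stdGaussianPair (s : ℝ × ℝ) :
    stdGaussianPair.map (· + s) = stdGaussianPair.withDensity (shiftDensity s) := by
  have h := Measure.map_prod_map (gaussianReal 0 1) (gaussianReal 0 1)
    (measurable_add_const s.1) (measurable_add_const s.2)
  have e : Prod.map (· + s.1) (· + s.2) = fun z : ℝ × ℝ => z + s := rfl
  rw [e] at h
  rw [← h, gaussianReal_map_add_eq_withDensity, gaussianReal_map_add_eq_withDensity,
    prod_withDensity (by fun_prop) (by fun_prop)]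
  congr 1
  ext z
  rw [← ENNReal.ofReal_mul (by positivity), ← Real.exp_add, shiftDensity]
  congr 2
  ring

/-- Only finitely many coordinates move, so the density is a finite product and no convergence
question arises. -/
theorem map_add_whiteNoise {s : ℤ → ℝ × ℝ} {S : Finset ℤ} (hs : ∀ n ∉ S, s n = 0) :
    whiteNoise.map (· + s) = whiteNoise.withDensity fun g =>
      ENNReal.ofReal (Real.exp (∑ n ∈ S, ((s n).1 * (g n).1 + (s n).2 * (g n).2) -
        (∑ n ∈ S, ((s n).1 ^ 2 + (s n).2 ^ 2)) / 2)) := by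
  have h1 : whiteNoise.map (· + s) =
      Measure.infinitePi fun n => stdGaussianPair.map (· + s n) :=
    Measure.infinitePi_map_pi (μ := fun _ : ℤ => stdGaussianPair) (f := fun n z => z + s n)
      fun n => measurable_add_const _
  have hp : ∀ n, IsProbabilityMeasure (stdGaussianPair.withDensity (shiftDensity (s n))) := by
    intro n
    rw [← map_add_stdGaussianPair]
    exact Measure.isProbabilityMeasure_map (by fun_prop)
  simp_rw [h1, map_add_stdGaussianPair]
  rw [infinitePi_withDensity (fun _ : ℤ => stdGaussianPair)
    (fun n => measurable_shiftDensity (s n)) S fun n hn => by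
      ext z; simp [shiftDensity, hs n hn]]
  change whiteNoise.withDensity _ = _
  congr 1
  ext g
  simp only [shiftDensity]
  rw [← ENNReal.ofReal_prod_of_nonneg fun _ _ => by positivity, ← Real.exp_sum,
    Finset.sum_sub_distrib, Finset.sum_div]

theorem map_neg_whiteNoise : whiteNoise.map (fun g => -g) = whiteNoise := by
  have h1 : whiteNoise.map (fun g => -g) =
      Measure.infinitePi fun _ => stdGaussianPair.map fun z => -z :=
    Measure.infinitePi_map_pi (μ := fun _ : ℤ => stdGaussianPair) (f := fun _ z => -z)
      fun _ => measurable_neg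
  have h2 : stdGaussianPair.map (fun z => -z) = stdGaussianPair := by
    have h := Measure.map_prod_map (gaussianReal 0 1) (gaussianReal 0 1)
      (measurable_neg (G := ℝ)) (measurable_neg (G := ℝ))
    have e : Prod.map (fun x : ℝ => -x) (fun x : ℝ => -x) = fun z : ℝ × ℝ => -z := rfl
    have e2 : (gaussianReal 0 1).map (fun x => -x) = gaussianReal 0 1 := by
      rw [gaussianReal_map_neg, neg_zero]
    change (Measure.map (fun x : ℝ => -x) _).prod (Measure.map (fun x : ℝ => -x) _) = _ at h
    rw [e2] at h
    exact h.symm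
  rw [h1, h2]; rfl

/-- Translating a symmetric set lowers its white noise measure by at most the Cameron-Martin
factor. -/
theorem exp_mul_whiteNoise_le {s : ℤ → ℝ × ℝ} {S : Finset ℤ} (hs : ∀ n ∉ S, s n = 0)
    {A : Set (ℤ → ℝ × ℝ)} (hA : MeasurableSet A) (hsymm : ∀ g, -g ∈ A ↔ g ∈ A) :
    ENNReal.ofReal (Real.exp (-(∑ n ∈ S, ((s n).1 ^ 2 + (s n).2 ^ 2)) / 2)) * whiteNoise A ≤
      whiteNoise.map (· + s) A := by
  let l : (ℤ → ℝ × ℝ) → ℝ := fun g => ∑ n ∈ S, ((s n).1 * (g n).1 + (s n).2 * (g n).2)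
  have hl : Measurable l := by fun_prop
  set q : ℝ := ∑ n ∈ S, ((s n).1 ^ 2 + (s n).2 ^ 2) with hq
  have hneg : ∀ g, l (-g) = - l g := fun g => by
    simp only [l, ← Finset.sum_neg_distrib]
    refine Finset.sum_congr rfl fun n _ => ?_
    simp only [Pi.neg_apply, Prod.fst_neg, Prod.snd_neg]
    ring
  have hf : ∀ c : ℝ, Measurable fun g => ENNReal.ofReal (Real.exp (c * l g)) := fun c => by
    fun_prop
  -- Both `A` and the white noise are invariant under `g ↦ -g`, while `l` is odd.
  have hswap : ∫⁻ g in A, ENNReal.ofReal (Real.exp (-1 * l g)) ∂whiteNoise =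
      ∫⁻ g in A, ENNReal.ofReal (Real.exp (1 * l g)) ∂whiteNoise := by
    rw [← lintegral_indicator hA, ← lintegral_indicator hA]
    conv_rhs => rw [← map_neg_whiteNoise]
    rw [lintegral_map ((hf 1).indicator hA) measurable_neg]
    refine lintegral_congr fun g => ?_
    by_cases hg : g ∈ A
    · rw [indicator_of_mem hg, indicator_of_mem ((hsymm g).2 hg), hneg]
      congr 2; ring
    · rw [indicator_of_notMem hg, indicator_of_notMem (mt (hsymm g).1 hg)]
  -- Averaging the two equal integrals replaces `exp l` by `cosh l ≥ 1`.
  have hexp : whiteNoise A ≤ ∫⁻ g in A, ENNReal.ofReal (Real.exp (1 * l g)) ∂whiteNoise := by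
    have h2 : 2 * whiteNoise A ≤
        2 * ∫⁻ g in A, ENNReal.ofReal (Real.exp (1 * l g)) ∂whiteNoise := by
      rw [two_mul (lintegral _ _)]
      nth_rewrite 1 [← hswap]
      rw [← lintegral_add_left (hf _), ← setLIntegral_const]
      refine lintegral_mono fun g => ?_
      rw [← ENNReal.ofReal_add (by positivity) (by positivity)]
      rw [show (2 : ℝ≥0∞) = ENNReal.ofReal 2 by simp]
      refine ENNReal.ofReal_le_ofReal ?_
      have := Real.one_le_cosh (l g)
      rw [Real.cosh_eq] at this
      rw [one_mul, neg_one_mul]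
      linarith
    exact (ENNReal.mul_le_mul_iff_right (by norm_num) (by norm_num)).1 h2
  rw [map_add_whiteNoise hs, withDensity_apply _ hA]
  refine (mul_le_mul_right hexp _).trans (le_of_eq ?_)
  rw [← lintegral_const_mul _ (hf 1)]
  refine lintegral_congr fun g => ?_
  rw [← ENNReal.ofReal_mul (by positivity), ← Real.exp_add]
  congr 2
  simp only [l, ← hq]
  ring

/-! ### Small balls for the random series -/

theorem bracket_pos (n : ℤ) : 0 < bracket n := Real.sqrt_pos.2 (by positivity)

theorem bracket_sq (n : ℤ) : bracket n ^ 2 = 1 + (2 * Real.pi * n) ^ 2 :=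
  Real.sq_sqrt (by positivity)

theorem stronglyMeasurable_randomSeries : StronglyMeasurable randomSeries :=
  stronglyMeasurable_tsum_fourierLp measurable_coeff

theorem randomSeries_neg (g : ℤ → ℝ × ℝ) : randomSeries (-g) = - randomSeries g := by
  unfold randomSeries
  rw [← tsum_neg]
  refine tsum_congr fun n => ?_
  rw [← neg_smul]
  congr 1
  simp only [coeff, Pi.neg_apply, Prod.fst_neg, Prod.snd_neg]
  push_cast
  ring

/-- The direction of the white noise that moves the random series by `∑ n ∈ S, c n e_n`. -/
noncomputable def shiftVector (S : Finset ℤ) (c : ℤ → ℂ) (n : ℤ) : ℝ × ℝ :=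
  if n ∈ S then (bracket n * (c n).re, bracket n * (c n).im) else 0

theorem coeff_add_shiftVector (S : Finset ℤ) (c : ℤ → ℂ) (g : ℤ → ℝ × ℝ) (n : ℤ) :
    coeff (g + shiftVector S c) n = coeff g n + if n ∈ S then c n else 0 := by
  have hb : (bracket n : ℂ) ≠ 0 := Complex.ofReal_ne_zero.2 (bracket_pos n).ne'
  by_cases hn : n ∈ S
  · simp only [coeff, Pi.add_apply, shiftVector, hn, if_true, Prod.fst_add, Prod.snd_add]
    rw [div_add' _ _ _ hb]
    congr 1
    conv_rhs => rw [← Complex.re_add_im (c n)]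
    push_cast
    ring
  · simp [coeff, shiftVector, hn]

theorem randomSeries_add_shiftVector (S : Finset ℤ) (c : ℤ → ℂ) {g : ℤ → ℝ × ℝ}
    (hg : Summable fun n => coeff g n • (fourierLp 2 n : Lp ℂ 2 haarT)) :
    randomSeries (g + shiftVector S c) =
      randomSeries g + ∑ n ∈ S, c n • (fourierLp 2 n : Lp ℂ 2 haarT) := by
  have h2 : HasSum (fun n => (if n ∈ S then c n else 0) • (fourierLp 2 n : Lp ℂ 2 haarT))
      (∑ n ∈ S, c n • (fourierLp 2 n : Lp ℂ 2 haarT)) := by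
    have := hasSum_sum_of_ne_finset_zero (s := S) (L := SummationFilter.unconditional ℤ)
      (f := fun n => (if n ∈ S then c n else 0) • (fourierLp 2 n : Lp ℂ 2 haarT))
      fun n hn => by simp [hn]
    convert this using 1
    exact Finset.sum_congr rfl fun n hn => by simp [hn]
  unfold randomSeries
  simp_rw [coeff_add_shiftVector, add_smul]
  exact (hg.hasSum.add h2).tsum_eq

theorem measurableSet_norm_randomSeries_le (δ : ℝ) :
    MeasurableSet {g | ‖randomSeries g‖ ≤ δ} :=
  measurableSet_le stronglyMeasurable_randomSeries.norm.measurable measurable_const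

/-- Holds up to a null set: the series is additive under the shift only where it converges. -/
theorem map_shift_ball_eq (S : Finset ℤ) (c : ℤ → ℂ) (δ : ℝ) :
    whiteNoise.map (· + shiftVector S (-c)) {g | ‖randomSeries g‖ ≤ δ} =
      whiteNoise {g | ‖randomSeries g - ∑ n ∈ S, c n • (fourierLp 2 n : Lp ℂ 2 haarT)‖ ≤ δ} := by
  rw [Measure.map_apply (by fun_prop) (measurableSet_norm_randomSeries_le δ)]
  refine measure_congr ?_
  filter_upwards [ae_summable_series] with g hg
  have := randomSeries_add_shiftVector S (-c) hg
  simp only [Pi.neg_apply, neg_smul, Finset.sum_neg_distrib, ← sub_eq_add_neg] at this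
  refine propext ?_
  change ‖randomSeries (g + shiftVector S (-c))‖ ≤ δ ↔ _
  rw [this]
  rfl

/-- The centred ball is symmetric, and `shiftVector` carries the weight `bracket n`, so the
Cameron-Martin cost is half the squared `H¹` norm of the new centre. -/
theorem exp_mul_smallBall_le (S : Finset ℤ) (c : ℤ → ℂ) (δ : ℝ) :
    ENNReal.ofReal (Real.exp (-(∑ n ∈ S, bracket n ^ 2 * ‖c n‖ ^ 2) / 2)) *
        whiteNoise {g | ‖randomSeries g‖ ≤ δ} ≤
      whiteNoise {g | ‖randomSeries g - ∑ n ∈ S, c n • (fourierLp 2 n : Lp ℂ 2 haarT)‖ ≤ δ} := by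
  rw [← map_shift_ball_eq]
  have := exp_mul_whiteNoise_le (s := shiftVector S (-c)) (S := S)
    (fun n hn => by simp [shiftVector, hn]) (measurableSet_norm_randomSeries_le δ)
    fun g => by simp [randomSeries_neg]
  convert this using 6
  refine Finset.sum_congr rfl fun n hn => ?_
  simp only [shiftVector, hn, if_true, Pi.neg_apply, Complex.neg_re, Complex.neg_im]
  rw [← Complex.normSq_eq_norm_sq, Complex.normSq_apply]
  ring

/-- If the centred ball were null, then by absolute continuity of the shifts so would be every ball
of that radius around a trigonometric polynomial. Countably many of these cover the separable space
`L²`. -/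
theorem smallBall_pos {δ : ℝ} (hδ : 0 < δ) : 0 < whiteNoise {g | ‖randomSeries g‖ ≤ δ} := by
  rw [pos_iff_ne_zero]
  intro h0
  have hdense : Dense (Submodule.span ℂ (range fun n : ℤ => (fourierLp 2 n : Lp ℂ 2 haarT)) :
      Set (Lp ℂ 2 haarT)) := by
    rw [dense_iff_closure_eq, ← Submodule.topologicalClosure_coe,
      span_fourierLp_closure_eq_top (by norm_num)]
    rfl
  have : Fact ((2 : ℝ≥0∞) ≠ ⊤) := ⟨by norm_num⟩
  have : SecondCountableTopology (Lp ℂ 2 haarT) := inferInstance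
  obtain ⟨t, hts, htc, htd⟩ := hdense.exists_countable_dense_subset
  have hnull : ∀ h ∈ t, whiteNoise {g | ‖randomSeries g - h‖ ≤ δ} = 0 := by
    intro h hh
    obtain ⟨c, rfl⟩ := Finsupp.mem_span_range_iff_exists_finsupp.1 (hts hh)
    change whiteNoise {g | ‖randomSeries g - ∑ n ∈ c.support, c n • _‖ ≤ δ} = 0
    rw [← map_shift_ball_eq, map_add_whiteNoise (S := c.support)
      fun n hn => by simp [shiftVector, hn]]
    exact withDensity_absolutelyContinuous _ _ h0
  have hcover : (univ : Set (ℤ → ℝ × ℝ)) ⊆ ⋃ h ∈ t, {g | ‖randomSeries g - h‖ ≤ δ} := by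
    intro g _
    obtain ⟨h, hh, hd⟩ := htd.exists_dist_lt (randomSeries g) hδ
    exact mem_biUnion hh (by simpa [dist_eq_norm] using hd.le)
  have := measure_mono_null hcover ((measure_biUnion_null_iff htc).2 hnull)
  rw [measure_univ] at this
  exact one_ne_zero this

/-! ### Truncation of functions in `H¹(ℝ)` -/

theorem integrable_continuous_mul {g u : ℝ → ℂ} (hg : Continuous g) (hc : HasCompactSupport g)
    (hu : MemLp u 2 volume) : Integrable (fun x => g x * u x) :=
  (hg.memLp_of_hasCompactSupport hc (p := 2)).integrable_mul hu

/-- Test the weak derivative of `u` with `ψ χ`, which has compact support although `ψ` need not. -/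
theorem integral_deriv_mul_cutoff_real {u u' : ℝ → ℂ} (hu : IsH1WithDeriv u u') {χ ψ : ℝ → ℝ}
    (hχ : ContDiff ℝ ∞ χ) (hχc : HasCompactSupport χ) (hψ : ContDiff ℝ ∞ ψ) :
    ∫ x, ((deriv ψ x : ℝ) : ℂ) * (χ x * u x) =
      - ∫ x, (ψ x : ℂ) * (χ x * u' x + (deriv χ x : ℝ) * u x) := by
  have h := hu.2.2 (fun x => ψ x * χ x) (hψ.mul hχ) hχc.mul_left
  have hd : ∀ x, deriv (fun x => ψ x * χ x) x = deriv ψ x * χ x + ψ x * deriv χ x := fun x =>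
    deriv_fun_mul (hψ.differentiable (by simp) x) (hχ.differentiable (by simp) x)
  have hψ' : Continuous (deriv ψ) := hψ.continuous_deriv (by simp)
  have hχ' : Continuous (deriv χ) := hχ.continuous_deriv (by simp)
  have hcoe : ∀ {k : ℝ → ℝ}, HasCompactSupport k → HasCompactSupport fun x => (k x : ℂ) :=
    fun hk => hk.comp_left (g := Complex.ofReal) Complex.ofReal_zero
  have i1 : Integrable fun x => ((deriv ψ x * χ x : ℝ) : ℂ) * u x :=
    integrable_continuous_mul (Complex.continuous_ofReal.comp (hψ'.mul hχ.continuous))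
      (hcoe hχc.mul_left) hu.1
  have i2 : Integrable fun x => ((ψ x * deriv χ x : ℝ) : ℂ) * u x :=
    integrable_continuous_mul (Complex.continuous_ofReal.comp (hψ.continuous.mul hχ'))
      (hcoe hχc.deriv.mul_left) hu.1
  have i3 : Integrable fun x => ((ψ x * χ x : ℝ) : ℂ) * u' x :=
    integrable_continuous_mul (Complex.continuous_ofReal.comp (hψ.continuous.mul hχ.continuous))
      (hcoe hχc.mul_left) hu.2.1
  have e1 : ∫ x, ((deriv (fun x => ψ x * χ x) x : ℝ) : ℂ) * u x =
      (∫ x, ((deriv ψ x * χ x : ℝ) : ℂ) * u x) + ∫ x, ((ψ x * deriv χ x : ℝ) : ℂ) * u x := by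
    rw [← integral_add i1 i2]
    refine integral_congr_ae (Eventually.of_forall fun x => ?_)
    simp only [hd]
    push_cast
    ring
  have e2 : ∫ x, (ψ x : ℂ) * (χ x * u' x + (deriv χ x : ℝ) * u x) =
      (∫ x, ((ψ x * χ x : ℝ) : ℂ) * u' x) + ∫ x, ((ψ x * deriv χ x : ℝ) : ℂ) * u x := by
    rw [← integral_add i3 i2]
    refine integral_congr_ae (Eventually.of_forall fun x => ?_)
    push_cast
    ring
  have e3 : ∫ x, ((deriv ψ x : ℝ) : ℂ) * (χ x * u x) =
      ∫ x, ((deriv ψ x * χ x : ℝ) : ℂ) * u x := by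
    refine integral_congr_ae (Eventually.of_forall fun x => ?_)
    push_cast
    ring
  rw [e1] at h
  rw [e2, e3]
  linear_combination h

/-- The functions `w`, `w'` satisfy `∫ ψ' w = - ∫ ψ w'` for all smooth complex `ψ`. -/
def HasGlobalWeakDeriv (w w' : ℝ → ℂ) : Prop :=
  ∀ ψ : ℝ → ℂ, ContDiff ℝ ∞ ψ → ∫ x, deriv ψ x * w x = - ∫ x, ψ x * w' x

/-- Extends the admissible test functions to complex ones without compact support, so that
exponentials can be inserted; real and imaginary parts are treated separately. -/
theorem IsH1WithDeriv.hasGlobalWeakDeriv_cutoff {u u' : ℝ → ℂ} (hu : IsH1WithDeriv u u')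
    {χ : ℝ → ℝ} (hχ : ContDiff ℝ ∞ χ) (hχc : HasCompactSupport χ) :
    HasGlobalWeakDeriv (fun x => χ x * u x) fun x => χ x * u' x + (deriv χ x : ℝ) * u x := by
  intro ψ hψ
  have hre : ContDiff ℝ ∞ fun x => (ψ x).re := Complex.reCLM.contDiff.comp hψ
  have him : ContDiff ℝ ∞ fun x => (ψ x).im := Complex.imCLM.contDiff.comp hψ
  have hd : ∀ x, HasDerivAt ψ (deriv ψ x) x := fun x =>
    (hψ.differentiable (by simp) x).hasDerivAt
  have hdre : ∀ x, deriv (fun x => (ψ x).re) x = (deriv ψ x).re := fun x =>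
    (Complex.reCLM.hasFDerivAt.comp_hasDerivAt x (hd x)).deriv
  have hdim : ∀ x, deriv (fun x => (ψ x).im) x = (deriv ψ x).im := fun x =>
    (Complex.imCLM.hasFDerivAt.comp_hasDerivAt x (hd x)).deriv
  have hχ' : Continuous (deriv χ) := hχ.continuous_deriv (by simp)
  have hcoe : ∀ {k : ℝ → ℝ}, HasCompactSupport k → HasCompactSupport fun x => (k x : ℂ) :=
    fun hk => hk.comp_left (g := Complex.ofReal) Complex.ofReal_zero
  have hint : ∀ {k : ℝ → ℝ}, Continuous k →
      Integrable fun x => (k x : ℂ) * (χ x * u x) := fun {k} hk => by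
    refine (integrable_continuous_mul (g := fun x => (k x : ℂ) * χ x) ?_ ?_ hu.1).congr
      (Eventually.of_forall fun x => mul_assoc _ _ _)
    · exact (Complex.continuous_ofReal.comp hk).mul (Complex.continuous_ofReal.comp hχ.continuous)
    · exact (hcoe hχc).mul_left
  have hint' : ∀ {k : ℝ → ℝ}, Continuous k →
      Integrable fun x => (k x : ℂ) * (χ x * u' x + (deriv χ x : ℝ) * u x) := fun {k} hk => by
    refine ((integrable_continuous_mul (g := fun x => (k x : ℂ) * χ x) ?_ ?_ hu.2.1).add
      (integrable_continuous_mul (g := fun x => (k x : ℂ) * (deriv χ x : ℝ)) ?_ ?_ hu.1)).congr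
      (Eventually.of_forall fun x => by simp only [Pi.add_apply]; ring)
    · exact (Complex.continuous_ofReal.comp hk).mul (Complex.continuous_ofReal.comp hχ.continuous)
    · exact (hcoe hχc).mul_left
    · exact (Complex.continuous_ofReal.comp hk).mul (Complex.continuous_ofReal.comp hχ')
    · exact (hcoe hχc.deriv).mul_left
  have e1 : ∫ x, deriv ψ x * (χ x * u x) =
      (∫ x, ((deriv (fun x => (ψ x).re) x : ℝ) : ℂ) * (χ x * u x)) +
        Complex.I * ∫ x, ((deriv (fun x => (ψ x).im) x : ℝ) : ℂ) * (χ x * u x) := by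
    rw [← integral_const_mul, ← integral_add (hint (hre.continuous_deriv (by simp)))
      ((hint (him.continuous_deriv (by simp))).const_mul _)]
    refine integral_congr_ae (Eventually.of_forall fun x => ?_)
    simp only [hdre, hdim]
    conv_lhs => rw [← Complex.re_add_im (deriv ψ x)]
    ring
  have e2 : ∫ x, ψ x * (χ x * u' x + (deriv χ x : ℝ) * u x) =
      (∫ x, ((ψ x).re : ℂ) * (χ x * u' x + (deriv χ x : ℝ) * u x)) +
        Complex.I * ∫ x, ((ψ x).im : ℂ) * (χ x * u' x + (deriv χ x : ℝ) * u x) := by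
    rw [← integral_const_mul, ← integral_add (hint' hre.continuous)
      ((hint' him.continuous).const_mul _)]
    refine integral_congr_ae (Eventually.of_forall fun x => ?_)
    have := Complex.re_add_im (ψ x)
    linear_combination -(χ x * u' x + (deriv χ x : ℝ) * u x) * this
  rw [e1, e2, integral_deriv_mul_cutoff_real hu hχ hχc hre,
    integral_deriv_mul_cutoff_real hu hχ hχc him]
  ring

theorem HasGlobalWeakDeriv.const_mul {w w' : ℝ → ℂ} (h : HasGlobalWeakDeriv w w') (c : ℂ) :
    HasGlobalWeakDeriv (fun x => c * w x) fun x => c * w' x := by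
  intro ψ hψ
  simp_rw [mul_left_comm _ c]
  rw [integral_const_mul, integral_const_mul, h ψ hψ, mul_neg]

/-! ### Dilations of the real line -/

/-- The `L²`-invariant dilation `√λ f(λx)`. -/
noncomputable def dil (l : ℝ) (f : ℝ → ℂ) (x : ℝ) : ℂ := (Real.sqrt l : ℂ) * f (l * x)

theorem lintegral_comp_mul_left {l : ℝ} (hl : 0 < l) (G : ℝ → ℝ≥0∞) :
    ∫⁻ x, G (l * x) = ENNReal.ofReal l⁻¹ * ∫⁻ x, G x := by
  have he : MeasurableEmbedding fun x : ℝ => l * x :=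
    (Homeomorph.mulLeft₀ l hl.ne').measurableEmbedding
  rw [← he.lintegral_map, Real.map_volume_mul_left hl.ne', lintegral_smul_measure,
    abs_of_pos (inv_pos.2 hl), smul_eq_mul]

/-- The exponent `r/2 - 1` is `0` for the mass and `2` for the sextic term. -/
theorem lintegral_dil_rpow {l : ℝ} (hl : 0 < l) (f : ℝ → ℂ) {r : ℝ} (hr : 0 ≤ r) :
    ∫⁻ x, ‖dil l f x‖ₑ ^ r = ENNReal.ofReal (l ^ (r / 2 - 1)) * ∫⁻ x, ‖f x‖ₑ ^ r := by
  have h0 : ENNReal.ofReal (l ^ (r / 2)) ≠ ⊤ := ENNReal.ofReal_ne_top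
  have e : ∀ x, ‖dil l f x‖ₑ ^ r = ENNReal.ofReal (l ^ (r / 2)) * ‖f (l * x)‖ₑ ^ r := by
    intro x
    rw [dil, enorm_mul, ENNReal.mul_rpow_of_nonneg _ _ hr]
    congr 1
    rw [← ofReal_norm, Complex.norm_real, Real.norm_of_nonneg (Real.sqrt_nonneg _),
      ENNReal.ofReal_rpow_of_nonneg (Real.sqrt_nonneg _) hr, Real.sqrt_eq_rpow,
      ← Real.rpow_mul hl.le]
    congr 2
    ring
  simp_rw [e]
  rw [lintegral_const_mul' _ _ h0, lintegral_comp_mul_left hl fun x => ‖f x‖ₑ ^ r, ← mul_assoc,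
    ← ENNReal.ofReal_mul (by positivity), Real.rpow_sub_one hl.ne',
    div_eq_mul_inv (l ^ _) l]

theorem eLpNorm_two_sq {α : Type*} [MeasurableSpace α] {m : Measure α} {E : Type*}
    [NormedAddCommGroup E] (f : α → E) : eLpNorm f 2 m ^ 2 = ∫⁻ x, ‖f x‖ₑ ^ (2 : ℝ) ∂m := by
  have := eLpNorm_nnreal_pow_eq_lintegral (f := f) (μ := m) (p := 2) (by norm_num)
  simpa using this

theorem eLpNorm_six_pow {α : Type*} [MeasurableSpace α] {m : Measure α} {E : Type*}
    [NormedAddCommGroup E] (f : α → E) : eLpNorm f 6 m ^ 6 = ∫⁻ x, ‖f x‖ₑ ^ (6 : ℝ) ∂m := by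
  have := eLpNorm_nnreal_pow_eq_lintegral (f := f) (μ := m) (p := 6) (by norm_num)
  have h6 : ((6 : NNReal) : ℝ) = (6 : ℕ) := by norm_num
  rw [h6, ENNReal.rpow_natCast] at this
  exact_mod_cast this

theorem eLpNorm_dil {l : ℝ} (hl : 0 < l) (f : ℝ → ℂ) :
    eLpNorm (dil l f) 2 volume = eLpNorm f 2 volume := by
  have h : eLpNorm (dil l f) 2 volume ^ 2 = eLpNorm f 2 volume ^ 2 := by
    rw [eLpNorm_two_sq, eLpNorm_two_sq, lintegral_dil_rpow hl f (by norm_num)]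
    norm_num
  exact (ENNReal.pow_right_strictMono two_ne_zero).injective h

theorem aestronglyMeasurable_dil {l : ℝ} (hl : 0 < l) {f : ℝ → ℂ}
    (hf : AEStronglyMeasurable f) : AEStronglyMeasurable (dil l f) := by
  refine AEStronglyMeasurable.const_mul ?_ _
  refine hf.comp_quasiMeasurePreserving (f := fun x => l * x) ⟨by fun_prop, ?_⟩
  rw [Real.map_volume_mul_left hl.ne']
  exact Measure.smul_absolutelyContinuous

theorem MemLp.dil {l : ℝ} (hl : 0 < l) {f : ℝ → ℂ} (hf : MemLp f 2 volume) :
    MemLp (dil l f) 2 volume :=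
  ⟨aestronglyMeasurable_dil hl hf.1, by rw [eLpNorm_dil hl]; exact hf.2⟩

theorem dil_inv_dil {l : ℝ} (hl : 0 < l) (f : ℝ → ℂ) : dil l⁻¹ (dil l f) = f := by
  ext x
  have h : (Real.sqrt l : ℂ) ≠ 0 := Complex.ofReal_ne_zero.2 (Real.sqrt_ne_zero'.2 hl)
  rw [dil, dil, mul_inv_cancel_left₀ hl.ne', Real.sqrt_inv, Complex.ofReal_inv,
    inv_mul_cancel_left₀ h]

theorem dil_sub (l : ℝ) (f g : ℝ → ℂ) : dil l (f - g) = dil l f - dil l g := by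
  ext x; simp [dil, mul_sub]

/-- The factor `l` gives the derivative energy the same growth `l²` as the sextic term. -/
theorem HasGlobalWeakDeriv.dil {w w' : ℝ → ℂ} (h : HasGlobalWeakDeriv w w') {l : ℝ} (hl : 0 < l) :
    HasGlobalWeakDeriv (dil l w) fun x => (l : ℂ) * dil l w' x := by
  intro ψ hψ
  have hl' : (l : ℂ) ≠ 0 := Complex.ofReal_ne_zero.2 hl.ne'
  have h1 := h (fun y => ψ (l⁻¹ * y)) (hψ.comp (contDiff_const.mul contDiff_id))
  have hd : ∀ y, deriv (fun y => ψ (l⁻¹ * y)) y = (l : ℂ)⁻¹ * deriv ψ (l⁻¹ * y) := fun y => by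
    rw [deriv_comp_mul_left]
    simp
  have e1 : ∫ x, deriv ψ x * TorusGibbs.dil l w x =
      (Real.sqrt l : ℂ) * ∫ x, deriv (fun y => ψ (l⁻¹ * y)) x * w x := by
    have := Measure.integral_comp_mul_left
      (fun y => deriv ψ (l⁻¹ * y) * ((Real.sqrt l : ℂ) * w y)) l
    simp only [inv_mul_cancel_left₀ hl.ne'] at this
    refine this.trans ?_
    rw [abs_of_pos (inv_pos.2 hl), Complex.real_smul, ← integral_const_mul, ← integral_const_mul]
    refine integral_congr_ae (Eventually.of_forall fun x => ?_)
    simp only [hd]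
    push_cast
    ring
  have e2 : ∫ x, ψ x * ((l : ℂ) * TorusGibbs.dil l w' x) =
      (Real.sqrt l : ℂ) * ∫ x, ψ (l⁻¹ * x) * w' x := by
    have := Measure.integral_comp_mul_left
      (fun y => ψ (l⁻¹ * y) * ((l : ℂ) * ((Real.sqrt l : ℂ) * w' y))) l
    simp only [inv_mul_cancel_left₀ hl.ne'] at this
    refine this.trans ?_
    rw [abs_of_pos (inv_pos.2 hl), Complex.real_smul, ← integral_const_mul, ← integral_const_mul]
    refine integral_congr_ae (Eventually.of_forall fun x => ?_)
    push_cast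
    field_simp
  rw [e1, e2, h1, mul_neg]

/-! ### Functions on the torus supported in a fundamental interval -/

/-- The restriction of `f` to `(-1/2, 1/2]`, as a function on the torus. -/
noncomputable def periodize (f : ℝ → ℂ) : UnitAddCircle → ℂ := AddCircle.liftIoc 1 (-1 / 2) f

/-- A function on the torus, read on `(-1/2, 1/2]` and extended by zero. -/
noncomputable def unfold (u : UnitAddCircle → ℂ) : ℝ → ℂ :=
  (Ioc (-1 / 2) (-1 / 2 + 1)).indicator fun x : ℝ => u (x : UnitAddCircle)

theorem measurePreserving_mk_haarT : MeasurePreserving ((↑) : ℝ → UnitAddCircle)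
    (volume.restrict (Ioc (-1 / 2) (-1 / 2 + 1))) haarT := by
  rw [← volume_eq_haarT]
  exact UnitAddCircle.measurePreserving_mk _

theorem aestronglyMeasurable_unfold {u : UnitAddCircle → ℂ} (hu : AEStronglyMeasurable u haarT) :
    AEStronglyMeasurable (unfold u) :=
  (aestronglyMeasurable_indicator_iff measurableSet_Ioc).2
    (hu.comp_measurePreserving measurePreserving_mk_haarT)

theorem lintegral_unfold (u : UnitAddCircle → ℂ) {r : ℝ} (hr : 0 < r) :
    ∫⁻ x, ‖unfold u x‖ₑ ^ r = ∫⁻ x, ‖u x‖ₑ ^ r ∂haarT := by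
  rw [← volume_eq_haarT, ← UnitAddCircle.lintegral_preimage (-1 / 2),
    ← lintegral_indicator measurableSet_Ioc]
  refine lintegral_congr fun x => ?_
  unfold TorusGibbs.unfold
  by_cases hx : x ∈ Ioc (-1 / 2 : ℝ) (-1 / 2 + 1)
  · rw [indicator_of_mem hx, indicator_of_mem hx]
  · rw [indicator_of_notMem hx, indicator_of_notMem hx, enorm_zero, ENNReal.zero_rpow_of_pos hr]

theorem eLpNorm_unfold {u : UnitAddCircle → ℂ} :
    eLpNorm (unfold u) 2 volume = eLpNorm u 2 haarT := by
  refine (ENNReal.pow_right_strictMono two_ne_zero).injective ?_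
  simp only [eLpNorm_two_sq]
  exact lintegral_unfold u (by norm_num)

theorem unfold_sub (u v : UnitAddCircle → ℂ) : unfold (u - v) = unfold u - unfold v :=
  indicator_sub _ _ _

theorem unfold_periodize {f : ℝ → ℂ} (hf : ∀ x, 1 / 2 ≤ |x| → f x = 0) :
    unfold (periodize f) = f := by
  ext x
  by_cases hx : x ∈ Ioc (-1 / 2 : ℝ) (-1 / 2 + 1)
  · rw [unfold, indicator_of_mem hx]
    exact AddCircle.liftIoc_coe_apply hx
  · rw [unfold, indicator_of_notMem hx, hf x]
    by_contra hlt
    rw [not_le, abs_lt] at hlt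
    exact hx ⟨by linarith [hlt.1], by linarith [hlt.2]⟩

theorem memLp_periodize {f : ℝ → ℂ} (hf : MemLp f 2 volume) : MemLp (periodize f) 2 haarT :=
  (MemLp.memLp_liftIoc (T := 1) (t := -1 / 2) (hf.restrict _)).haarAddCircle

theorem fourierCoeff_periodize {f : ℝ → ℂ} (hf : ∀ x, 1 / 2 ≤ |x| → f x = 0) (n : ℤ) :
    fourierCoeff (periodize f) n = ∫ x : ℝ, fourier (-n) (x : UnitAddCircle) * f x := by
  have h1 : fourierCoeff (periodize f) n = ∫ x in Ioc (-1 / 2 : ℝ) (-1 / 2 + 1),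
      fourier (-n) (x : UnitAddCircle) * periodize f (x : UnitAddCircle) := by
    rw [fourierCoeff_eq_intervalIntegral _ n (-1 / 2), intervalIntegral.integral_of_le (by norm_num)]
    simp
  rw [h1, ← integral_indicator measurableSet_Ioc]
  refine integral_congr_ae (Eventually.of_forall fun x => ?_)
  have h := congrFun (unfold_periodize hf) x
  by_cases hx : x ∈ Ioc (-1 / 2 : ℝ) (-1 / 2 + 1)
  · rw [unfold, indicator_of_mem hx] at h
    simp only [indicator_of_mem hx, h]
  · rw [unfold, indicator_of_notMem hx] at h
    simp only [indicator_of_notMem hx, ← h, mul_zero]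

/-- Take an exponential as test function; the support condition excludes boundary terms. -/
theorem fourierCoeff_periodize_deriv {v v' : ℝ → ℂ} (hv : ∀ x, 1 / 2 ≤ |x| → v x = 0)
    (hv' : ∀ x, 1 / 2 ≤ |x| → v' x = 0) (h : HasGlobalWeakDeriv v v') (n : ℤ) :
    fourierCoeff (periodize v') n =
      (2 * Real.pi * Complex.I * n) * fourierCoeff (periodize v) n := by
  rw [fourierCoeff_periodize hv, fourierCoeff_periodize hv']
  have h1 := h _ (contDiff_fourier (-n))
  have hd : ∀ x : ℝ, deriv (fun y : ℝ => fourier (-n) (y : UnitAddCircle)) x =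
      -(2 * Real.pi * Complex.I * n) * fourier (-n) (x : UnitAddCircle) := fun x => by
    rw [(hasDerivAt_fourier 1 (-n) x).deriv]
    push_cast
    ring
  simp_rw [hd, mul_assoc] at h1
  rw [integral_const_mul] at h1
  rw [← neg_inj, ← h1]
  ring

theorem sum_sq_fourierCoeff_le {f : UnitAddCircle → ℂ} (hf : MemLp f 2 haarT) (S : Finset ℤ) :
    ∑ n ∈ S, ‖fourierCoeff f n‖ ^ 2 ≤ (eLpNorm f 2 haarT).toReal ^ 2 := by
  rw [← Lp.norm_toLp f hf]
  have := fourierBasis.orthonormal.sum_inner_products_le (hf.toLp f) (s := S)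
  refine le_trans (Finset.sum_le_sum fun n _ => le_of_eq ?_) this
  rw [← HilbertBasis.repr_apply_apply, fourierBasis_repr,
    fourierCoeff_congr_ae hf.coeFn_toLp]

theorem eLpNorm_periodize {f : ℝ → ℂ} (hf : ∀ x, 1 / 2 ≤ |x| → f x = 0) :
    eLpNorm (periodize f) 2 haarT = eLpNorm f 2 volume := by
  rw [← eLpNorm_unfold, unfold_periodize hf]

/-- Bessel's inequality for `v` and for `v'`, since `bracket n ^ 2 = 1 + (2πn)²`. The bound is
uniform in `S`. -/
theorem sum_bracket_sq_mul_le {v v' : ℝ → ℂ} (hv2 : MemLp v 2 volume) (hv2' : MemLp v' 2 volume)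
    (hv : ∀ x, 1 / 2 ≤ |x| → v x = 0)
    (hv' : ∀ x, 1 / 2 ≤ |x| → v' x = 0) (h : HasGlobalWeakDeriv v v') (S : Finset ℤ) :
    ∑ n ∈ S, bracket n ^ 2 * ‖fourierCoeff (periodize v) n‖ ^ 2 ≤
      (eLpNorm v 2 volume).toReal ^ 2 + (eLpNorm v' 2 volume).toReal ^ 2 := by
  have h1 := sum_sq_fourierCoeff_le (memLp_periodize hv2) S
  have h2 := sum_sq_fourierCoeff_le (memLp_periodize hv2') S
  rw [eLpNorm_periodize hv] at h1
  rw [eLpNorm_periodize hv'] at h2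
  refine le_trans (le_of_eq ?_) (add_le_add h1 h2)
  rw [← Finset.sum_add_distrib]
  refine Finset.sum_congr rfl fun n _ => ?_
  rw [fourierCoeff_periodize_deriv hv hv' h, norm_mul, mul_pow, bracket_sq]
  have h3 : ‖(2 * Real.pi * Complex.I * n : ℂ)‖ = 2 * Real.pi * |(n : ℝ)| := by
    simp [abs_of_pos Real.pi_pos]
  rw [h3, mul_pow _ |(n : ℝ)|, sq_abs]
  ring

/-- A lower bound for `∫ |u|^6` near a concentrated profile, uniform in the concentration scale. -/
theorem exists_lt_lintegral_six_of_near_dil {w : ℝ → ℂ} (hw : AEStronglyMeasurable w)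
    {c : ℝ≥0∞} (hc : c < ∫⁻ x, ‖w x‖ₑ ^ (6 : ℝ)) :
    ∃ δ : ℝ, 0 < δ ∧ ∀ l : ℝ, 0 < l → (∀ x, 1 / 2 ≤ |x| → dil l w x = 0) →
      ∀ u : UnitAddCircle → ℂ, AEStronglyMeasurable u haarT →
        eLpNorm (u - periodize (dil l w)) 2 haarT ≤ ENNReal.ofReal δ →
          ENNReal.ofReal (l ^ 2) * c ≤ ∫⁻ x, ‖u x‖ₑ ^ (6 : ℝ) ∂haarT := by
  obtain ⟨δ, hδ, h⟩ := exists_eLpNorm_sub_le_imp_lt_lintegral_rpow hw hc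
  refine ⟨δ, hδ, fun l hl hsupp u hu hle => ?_⟩
  -- Undoing the dilation compares `u` with the fixed profile `w` at the same `L²` distance; hence
  -- `δ` does not depend on `l`.
  have h1 := h (dil l⁻¹ (unfold u))
    (aestronglyMeasurable_dil (inv_pos.2 hl) (aestronglyMeasurable_unfold hu)) ?_
  · rw [lintegral_dil_rpow (inv_pos.2 hl) _ (by norm_num), lintegral_unfold u (by norm_num)] at h1
    refine (mul_le_mul_right h1.le _).trans (le_of_eq ?_)
    rw [← mul_assoc, ← ENNReal.ofReal_mul (by positivity)]
    have : l ^ 2 * l⁻¹ ^ ((6 : ℝ) / 2 - 1) = 1 := by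
      rw [show (6 : ℝ) / 2 - 1 = (2 : ℕ) by norm_num, Real.rpow_natCast, ← mul_pow,
        mul_inv_cancel₀ hl.ne', one_pow]
    rw [this, ENNReal.ofReal_one, one_mul]
  · have e : dil l⁻¹ (unfold u) - w = dil l⁻¹ (unfold (u - periodize (dil l w))) := by
      rw [unfold_sub, unfold_periodize hsupp, dil_sub, dil_inv_dil hl]
    rwa [e, eLpNorm_dil (inv_pos.2 hl), eLpNorm_unfold]

/-! ### A compactly supported competitor of slightly smaller mass -/

/-- The cutoff function `χ(x / R)`, equal to `1` on `[-R, R]` and to `0` outside `[-2R, 2R]`. -/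
noncomputable def cutoff (R x : ℝ) : ℝ :=
  (⟨1, 2, by norm_num, by norm_num⟩ : ContDiffBump (0 : ℝ)) (R⁻¹ * x)

theorem contDiff_cutoff (R : ℝ) : ContDiff ℝ ∞ (cutoff R) :=
  (ContDiffBump.contDiff _).comp (contDiff_const.mul contDiff_id)

theorem cutoff_nonneg (R x : ℝ) : 0 ≤ cutoff R x := ContDiffBump.nonneg _

theorem cutoff_le_one (R x : ℝ) : cutoff R x ≤ 1 := ContDiffBump.le_one _

theorem cutoff_eq_one {R x : ℝ} (hR : 0 < R) (hx : |x| ≤ R) : cutoff R x = 1 := by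
  refine ContDiffBump.one_of_mem_closedBall _ ?_
  rw [mem_closedBall_zero_iff, Real.norm_eq_abs, abs_mul, abs_of_pos (inv_pos.2 hR),
    inv_mul_le_iff₀ hR]
  simpa using hx

theorem cutoff_eq_zero {R x : ℝ} (hR : 0 < R) (hx : 2 * R ≤ |x|) : cutoff R x = 0 := by
  refine ContDiffBump.zero_of_le_dist _ ?_
  rw [dist_zero_right, Real.norm_eq_abs, abs_mul, abs_of_pos (inv_pos.2 hR),
    le_inv_mul_iff₀ hR]
  linarith

theorem hasCompactSupport_cutoff {R : ℝ} (hR : 0 < R) : HasCompactSupport (cutoff R) := by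
  refine HasCompactSupport.of_support_subset_isCompact (isCompact_Icc (a := -(2 * R)) (b := 2 * R))
    fun x hx => ?_
  by_contra h
  refine hx (cutoff_eq_zero hR ?_)
  by_contra h2
  exact h (abs_le.1 (not_le.1 h2).le)

theorem exists_abs_deriv_cutoff_le : ∃ C : ℝ, 0 ≤ C ∧ ∀ R : ℝ, 0 < R → ∀ x,
    |deriv (cutoff R) x| ≤ R⁻¹ * C := by
  have h1 : Continuous (deriv (cutoff 1)) := (contDiff_cutoff 1).continuous_deriv (by simp)
  obtain ⟨C, hC⟩ := h1.bounded_above_of_compact_support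
    (hasCompactSupport_cutoff one_pos).deriv
  refine ⟨C, (norm_nonneg _).trans (hC 0), fun R hR x => ?_⟩
  have e : cutoff R = fun x => cutoff 1 (R⁻¹ * x) := by
    ext x; simp [cutoff]
  rw [e, deriv_comp_mul_left, smul_eq_mul, abs_mul, abs_of_pos (inv_pos.2 hR)]
  exact mul_le_mul_of_nonneg_left (hC _) (inv_pos.2 hR).le

theorem deriv_cutoff_eq_zero {R x : ℝ} (hR : 0 < R) (hx : 2 * R < |x|) :
    deriv (cutoff R) x = 0 := by
  have : cutoff R =ᶠ[𝓝 x] fun _ => 0 := by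
    filter_upwards [(isOpen_lt continuous_const continuous_abs).mem_nhds hx] with y hy
    exact cutoff_eq_zero hR (le_of_lt hy)
  rw [this.deriv_eq, deriv_const]

theorem eLpNorm_const_mul_le {f g : ℝ → ℂ} {a : ℝ} (h : ∀ x, ‖f x‖ ≤ a * ‖g x‖) :
    eLpNorm f 2 volume ≤ ENNReal.ofReal a * eLpNorm g 2 volume :=
  eLpNorm_le_mul_eLpNorm_of_ae_le_mul (Eventually.of_forall h) 2

theorem tendsto_lintegral_cutoff {Q : ℝ → ℂ} (hQ : AEStronglyMeasurable Q)
    (h6 : ∫⁻ x, ‖Q x‖ₑ ^ (6 : ℝ) ≠ ⊤) (a : ℝ) :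
    Tendsto (fun n : ℕ => ∫⁻ x, ‖(a : ℂ) * (cutoff ((n : ℝ) + 1) x * Q x)‖ₑ ^ (6 : ℝ)) atTop
      (𝓝 (∫⁻ x, ‖(a : ℂ) * Q x‖ₑ ^ (6 : ℝ))) := by
  refine tendsto_lintegral_of_dominated_convergence' (fun x => ‖(a : ℂ) * Q x‖ₑ ^ (6 : ℝ))
    (fun n => ?_) (fun n => Eventually.of_forall fun x => ?_) ?_ (Eventually.of_forall fun x => ?_)
  · have hc : Continuous fun x => (cutoff ((n : ℝ) + 1) x : ℂ) :=
      Complex.continuous_ofReal.comp (contDiff_cutoff _).continuous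
    exact ((hc.aestronglyMeasurable.mul hQ).const_mul _).enorm.pow_const _
  · refine ENNReal.rpow_le_rpow ?_ (by norm_num)
    simp only [enorm_mul]
    refine mul_le_mul_right ?_ _
    refine (mul_le_mul_left ?_ _).trans_eq (one_mul _)
    rw [← ofReal_norm, Complex.norm_real, Real.norm_of_nonneg (cutoff_nonneg _ _)]
    exact ENNReal.ofReal_le_one.2 (cutoff_le_one _ _)
  · simp_rw [enorm_mul, ENNReal.mul_rpow_of_nonneg _ _ (by norm_num : (0 : ℝ) ≤ 6)]
    have ha : ‖(a : ℂ)‖ₑ ^ (6 : ℝ) ≠ ⊤ := ENNReal.rpow_ne_top_of_nonneg (by norm_num) enorm_ne_top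
    rw [lintegral_const_mul' _ _ ha]
    exact ENNReal.mul_ne_top ha h6
  · refine tendsto_const_nhds.congr' ?_
    filter_upwards [eventually_ge_atTop ⌈|x|⌉₊] with n hn
    rw [cutoff_eq_one (by positivity)]
    · simp
    · have := Nat.ceil_le.1 hn
      linarith

/-- The properties of the competitor that are used: it is supported in `(-R, R)`, has mass less
than that of `Q`, and its Sobolev energy is beaten by the `L⁶` norm. -/
structure IsCompetitor (K : ℝ≥0∞) (p : ℝ) (w w' : ℝ → ℂ) (R c₆ c₂ : ℝ) : Prop where
  memLp : MemLp w 2 volume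
  memLp' : MemLp w' 2 volume
  eq_zero : ∀ x, R ≤ |x| → w x = 0
  eq_zero' : ∀ x, R ≤ |x| → w' x = 0
  weakDeriv : HasGlobalWeakDeriv w w'
  mass_lt : eLpNorm w 2 volume < K
  six_nonneg : 0 ≤ c₆
  lt_six : ENNReal.ofReal c₆ < ∫⁻ x, ‖w x‖ₑ ^ (6 : ℝ)
  energy_le : (eLpNorm w' 2 volume).toReal ^ 2 ≤ c₂
  lt : c₂ < p / 3 * c₆

/-- The competitor is `a χ(x/R) Q` with `a < 1` near `1` and `R` large. Shrinking by `a` gives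
strictly smaller mass, and `p > 1` leaves room for this loss and for the cutoff error. -/
theorem exists_isCompetitor {Q : ℝ → ℝ} (hQ : IsGNSOptimiser Q) {p : ℝ} (hp : 1 < p) :
    ∃ w w' R c₆ c₂, 0 < R ∧ IsCompetitor (eLpNorm Q 2 volume) p w w' R c₆ c₂ := by
  obtain ⟨hpos, -, Q', hH1, -, hnorm⟩ := hQ
  set Qc : ℝ → ℂ := fun x => (Q x : ℂ) with hQc
  have hcast : ∀ r : ℝ≥0∞, eLpNorm Q r volume = eLpNorm Qc r volume := fun r =>
    eLpNorm_congr_norm_ae (Eventually.of_forall fun x => by simp [Qc])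
  rw [hcast] at hnorm ⊢
  have hfin : eLpNorm Qc 2 volume ≠ ⊤ := hH1.1.2.ne
  have hfin' : eLpNorm Q' 2 volume ≠ ⊤ := hH1.2.1.2.ne
  have hne : ∀ r : ℝ≥0∞, r ≠ 0 → eLpNorm Qc r volume ≠ 0 := fun r hr h => by
    rw [eLpNorm_eq_zero_iff hH1.1.1 hr] at h
    obtain ⟨x, hx⟩ := h.exists
    exact (hpos x).ne' (Complex.ofReal_eq_zero.1 hx)
  set q : ℝ := (eLpNorm Qc 2 volume).toReal with hq
  set b : ℝ := (eLpNorm Q' 2 volume).toReal with hb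
  have hqe : eLpNorm Qc 2 volume = ENNReal.ofReal q := (ENNReal.ofReal_toReal hfin).symm
  have hbe : eLpNorm Q' 2 volume = ENNReal.ofReal b := (ENNReal.ofReal_toReal hfin').symm
  -- By the normalisation, `Q' = 0` would force `Q = 0`.
  have hb0 : 0 < b := by
    refine ENNReal.toReal_pos (fun h => ?_) hfin'
    rw [h] at hnorm
    exact hne 6 (by norm_num) (by simpa using hnorm)
  have h6 : ∫⁻ x, ‖Qc x‖ₑ ^ (6 : ℝ) = ENNReal.ofReal (3 * b ^ 2) := by
    rw [← eLpNorm_six_pow, hnorm, hbe, ENNReal.ofReal_mul (by norm_num),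
      ENNReal.ofReal_pow hb0.le]
    simp
  -- a factor slightly less than one
  obtain ⟨a, ha0, ha1, hpa⟩ : ∃ a : ℝ, 0 < a ∧ a < 1 ∧ 1 < p * a ^ 4 := by
    have hc : Tendsto (fun a : ℝ => p * a ^ 4) (𝓝[<] 1) (𝓝 (p * 1 ^ 4)) :=
      ((continuous_const.mul (continuous_pow 4)).tendsto 1).mono_left nhdsWithin_le_nhds
    have h1 := hc.eventually_const_lt (by simpa using hp)
    have h2 : ∀ᶠ a : ℝ in 𝓝[<] 1, 0 < a :=
      nhdsWithin_le_nhds (lt_mem_nhds one_pos)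
    obtain ⟨a, h, h', h''⟩ := (h1.and (h2.and self_mem_nhdsWithin)).exists
    exact ⟨a, h', h'', h⟩
  -- As `R → ∞` the energy bound tends to `a² b²` and the sextic integral to `3 a⁶ b²`. Because `p
  -- a⁴ > 1`, constants fit strictly between: `c₂` above the first limit, `c₆` below the second,
  -- with `c₂ < (p/3) c₆`.
  obtain ⟨c₂, hc2, hc2'⟩ : ∃ c₂, (a * b) ^ 2 < c₂ ∧ c₂ < p * a ^ 6 * b ^ 2 := by
    refine exists_between ?_
    have : 0 < (a * b) ^ 2 := by positivity
    nlinarith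
  obtain ⟨c₆, hc6, hc6'⟩ : ∃ c₆, 3 * c₂ / p < c₆ ∧ c₆ < 3 * a ^ 6 * b ^ 2 := by
    refine exists_between ?_
    rw [div_lt_iff₀ (by linarith)]
    linarith
  have hc2pos : 0 < c₂ := lt_trans (by positivity) hc2
  have hc6pos : 0 < c₆ := lt_trans (by positivity) hc6
  obtain ⟨C, hC0, hC⟩ := exists_abs_deriv_cutoff_le
  let w : ℕ → ℝ → ℂ := fun n x => (a : ℂ) * (cutoff ((n : ℝ) + 1) x * Qc x)
  let w' : ℕ → ℝ → ℂ := fun n x => (a : ℂ) *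
    (cutoff ((n : ℝ) + 1) x * Q' x + (deriv (cutoff ((n : ℝ) + 1)) x : ℝ) * Qc x)
  have hR : ∀ n : ℕ, (0 : ℝ) < (n : ℝ) + 1 := fun n => by positivity
  have hcut : ∀ (n : ℕ) (z : ℂ) (x : ℝ), ‖(cutoff ((n : ℝ) + 1) x : ℂ) * z‖ ≤ 1 * ‖z‖ :=
    fun n z x => by
      rw [norm_mul, Complex.norm_real, Real.norm_of_nonneg (cutoff_nonneg _ _)]
      exact mul_le_mul_of_nonneg_right (cutoff_le_one _ _) (norm_nonneg _)
  have hm1 : ∀ n : ℕ, AEStronglyMeasurable (fun x => (cutoff ((n : ℝ) + 1) x : ℂ)) volume :=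
    fun n => (Complex.continuous_ofReal.comp
      (contDiff_cutoff _).continuous).aestronglyMeasurable
  have hm2 : ∀ n : ℕ, AEStronglyMeasurable
      (fun x => ((deriv (cutoff ((n : ℝ) + 1)) x : ℝ) : ℂ)) volume :=
    fun n => (Complex.continuous_ofReal.comp
      ((contDiff_cutoff _).continuous_deriv (by simp))).aestronglyMeasurable
  have hw2 : ∀ n, eLpNorm (w n) 2 volume ≤ ENNReal.ofReal a * eLpNorm Qc 2 volume := fun n =>
    eLpNorm_const_mul_le fun x => by
      rw [norm_mul, Complex.norm_real, Real.norm_of_nonneg ha0.le]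
      exact mul_le_mul_of_nonneg_left ((hcut n _ x).trans_eq (one_mul _)) ha0.le
  -- The derivative falling on the cutoff costs only `O(1/R)`, where `R = n + 1`.
  have hw2' : ∀ n : ℕ, eLpNorm (w' n) 2 volume ≤
      ENNReal.ofReal (a * (b + ((n : ℝ) + 1)⁻¹ * C * q)) := by
    intro n
    have hCn : 0 ≤ ((n : ℝ) + 1)⁻¹ * C := mul_nonneg (inv_pos.2 (hR n)).le hC0
    have h1 : eLpNorm (fun x => (cutoff ((n : ℝ) + 1) x : ℂ) * Q' x) 2 volume ≤
        ENNReal.ofReal 1 * eLpNorm Q' 2 volume := eLpNorm_const_mul_le fun x => hcut n _ x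
    have h2 : eLpNorm (fun x => ((deriv (cutoff ((n : ℝ) + 1)) x : ℝ) : ℂ) * Qc x) 2 volume ≤
        ENNReal.ofReal (((n : ℝ) + 1)⁻¹ * C) * eLpNorm Qc 2 volume :=
      eLpNorm_const_mul_le fun x => by
        rw [norm_mul, Complex.norm_real, Real.norm_eq_abs]
        exact mul_le_mul_of_nonneg_right (hC _ (hR n) x) (norm_nonneg _)
    have h3 := eLpNorm_add_le ((hm1 n).mul hH1.2.1.1) ((hm2 n).mul hH1.1.1)
      (p := 2) (by norm_num)
    have h4 : eLpNorm (w' n) 2 volume ≤ ENNReal.ofReal a * eLpNorm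
        ((fun x => (cutoff ((n : ℝ) + 1) x : ℂ) * Q' x) +
          fun x => ((deriv (cutoff ((n : ℝ) + 1)) x : ℝ) : ℂ) * Qc x) 2 volume :=
      eLpNorm_const_mul_le fun x => by
        rw [norm_mul, Complex.norm_real, Real.norm_of_nonneg ha0.le]
        rfl
    refine h4.trans ?_
    rw [ENNReal.ofReal_mul ha0.le]
    refine mul_le_mul_right (h3.trans ((add_le_add h1 h2).trans (le_of_eq ?_))) _
    rw [hbe, hqe, ENNReal.ofReal_one, one_mul, ← ENNReal.ofReal_mul hCn,
      ← ENNReal.ofReal_add hb0.le (mul_nonneg hCn ENNReal.toReal_nonneg)]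
  have hlim6 : ∀ᶠ n : ℕ in atTop, ENNReal.ofReal c₆ < ∫⁻ x, ‖w n x‖ₑ ^ (6 : ℝ) := by
    refine (tendsto_lintegral_cutoff hH1.1.1 (by rw [h6]; exact ENNReal.ofReal_ne_top)
      a).eventually_const_lt ?_
    simp_rw [enorm_mul, ENNReal.mul_rpow_of_nonneg _ _ (by norm_num : (0 : ℝ) ≤ 6)]
    rw [lintegral_const_mul' _ _ (ENNReal.rpow_ne_top_of_nonneg (by norm_num) enorm_ne_top), h6,
      ← ofReal_norm, Complex.norm_real, Real.norm_of_nonneg ha0.le,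
      ENNReal.ofReal_rpow_of_pos ha0, ← ENNReal.ofReal_mul (by positivity)]
    refine (ENNReal.ofReal_lt_ofReal_iff (by positivity)).2 (hc6'.trans_eq ?_)
    rw [show (6 : ℝ) = (6 : ℕ) by norm_num, Real.rpow_natCast]
    ring
  have hlim2 : ∀ᶠ n : ℕ in atTop, (a * (b + ((n : ℝ) + 1)⁻¹ * C * q)) ^ 2 < c₂ := by
    have h1 : Tendsto (fun n : ℕ => ((n : ℝ) + 1)⁻¹) atTop (𝓝 0) := by
      simpa [one_div] using tendsto_one_div_add_atTop_nhds_zero_nat (𝕜 := ℝ)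
    have h2 := ((((h1.mul_const C).mul_const q).const_add b).const_mul a).pow 2
    simp only [zero_mul, add_zero] at h2
    exact h2.eventually_lt_const hc2
  obtain ⟨n, hn6, hn2⟩ := (hlim6.and hlim2).exists
  have hwm : AEStronglyMeasurable (w n) volume := ((hm1 n).mul hH1.1.1).const_mul _
  have hwm' : AEStronglyMeasurable (w' n) volume :=
    (((hm1 n).mul hH1.2.1.1).add ((hm2 n).mul hH1.1.1)).const_mul _
  have hnn : 0 ≤ a * (b + ((n : ℝ) + 1)⁻¹ * C * q) :=
    mul_nonneg ha0.le (add_nonneg hb0.le (mul_nonneg (mul_nonneg (inv_pos.2 (hR n)).le hC0)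
      ENNReal.toReal_nonneg))
  -- The extra `1` gives the strict inequality `2R < |x|` under which `deriv_cutoff_eq_zero`
  -- applies.
  refine ⟨w n, w' n, 2 * ((n : ℝ) + 1) + 1, c₆, c₂, by positivity, ?_⟩
  refine
    { memLp := ⟨hwm, (hw2 n).trans_lt (ENNReal.mul_lt_top ENNReal.ofReal_lt_top hH1.1.2)⟩
      memLp' := ⟨hwm', (hw2' n).trans_lt ENNReal.ofReal_lt_top⟩
      eq_zero := fun x hx => ?_
      eq_zero' := fun x hx => ?_
      weakDeriv := (hH1.hasGlobalWeakDeriv_cutoff (contDiff_cutoff _)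
        (hasCompactSupport_cutoff (hR n))).const_mul a
      mass_lt := (hw2 n).trans_lt ?_
      six_nonneg := hc6pos.le
      lt_six := hn6
      energy_le := ?_
      lt := ?_ }
  · simp [w, cutoff_eq_zero (hR n) (by linarith : 2 * ((n : ℝ) + 1) ≤ |x|)]
  · simp [w', cutoff_eq_zero (hR n) (by linarith : 2 * ((n : ℝ) + 1) ≤ |x|),
      deriv_cutoff_eq_zero (hR n) (by linarith : 2 * ((n : ℝ) + 1) < |x|)]
  · have hq0 : 0 < q := ENNReal.toReal_pos (hne 2 (by norm_num)) hfin
    rw [hqe, ← ENNReal.ofReal_mul ha0.le]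
    exact (ENNReal.ofReal_lt_ofReal_iff hq0).2 (by nlinarith)
  · exact (pow_le_pow_left₀ ENNReal.toReal_nonneg (ENNReal.toReal_le_of_le_ofReal hnn (hw2' n))
      2).trans hn2.le
  · rw [div_lt_iff₀ (by linarith)] at hc6
    linarith

/-! ### Divergence of the partition function -/

/-- Restrict to the ball around the trigonometric polynomial: the weight there is at least `exp(β
m)`, and Cameron-Martin bounds the measure of the ball. -/
theorem le_lintegral_gibbsWeight {β : ℝ} (hβ : 0 ≤ β) (K : ℝ≥0∞) (S : Finset ℤ) (c : ℤ → ℂ)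
    {ε m : ℝ} (hm : 0 ≤ m)
    (h : ∀ f : Lp ℂ 2 haarT, ‖f - ∑ n ∈ S, c n • (fourierLp 2 n : Lp ℂ 2 haarT)‖ ≤ ε →
      ∫⁻ x, ‖f x‖ₑ ^ (2 : ℝ) ∂haarT ≤ K ∧
        ENNReal.ofReal m ≤ ∫⁻ x, ‖f x‖ₑ ^ (6 : ℝ) ∂haarT) :
    ENNReal.ofReal (Real.exp (β * m - (∑ n ∈ S, bracket n ^ 2 * ‖c n‖ ^ 2) / 2)) *
        whiteNoise {g | ‖randomSeries g‖ ≤ ε} ≤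
      ∫⁻ u, gibbsWeight β K u ∂gaussianMeasure := by
  set E : Set (ℤ → ℝ × ℝ) :=
    {g | ‖randomSeries g - ∑ n ∈ S, c n • (fourierLp 2 n : Lp ℂ 2 haarT)‖ ≤ ε} with hE
  have hEm : MeasurableSet E :=
    measurableSet_le (stronglyMeasurable_randomSeries.sub stronglyMeasurable_const).norm.measurable
      measurable_const
  have hlow : ∀ g ∈ E, ENNReal.ofReal (Real.exp (β * m)) ≤
      gibbsWeight β K (TorusDistribution.ofLp (randomSeries g)) := by
    intro g hg
    obtain ⟨h2, h6⟩ := h _ hg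
    rw [gibbsWeight_ofLp, indicator_of_mem (by exact h2)]
    refine le_trans (le_of_eq ?_) (monotone_exp_mul hβ h6)
    simp only
    rw [EReal.coe_ennreal_ofReal, max_eq_left hm, ← EReal.coe_mul, EReal.exp_coe]
  calc ENNReal.ofReal (Real.exp (β * m - (∑ n ∈ S, bracket n ^ 2 * ‖c n‖ ^ 2) / 2)) *
        whiteNoise {g | ‖randomSeries g‖ ≤ ε}
      = ENNReal.ofReal (Real.exp (β * m)) *
        (ENNReal.ofReal (Real.exp (-(∑ n ∈ S, bracket n ^ 2 * ‖c n‖ ^ 2) / 2)) *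
          whiteNoise {g | ‖randomSeries g‖ ≤ ε}) := by
        rw [← mul_assoc, ← ENNReal.ofReal_mul (by positivity), ← Real.exp_add]
        congr 3
        ring
    _ ≤ ENNReal.ofReal (Real.exp (β * m)) * whiteNoise E :=
        mul_le_mul_right (exp_mul_smallBall_le S c ε) _
    _ = ∫⁻ _ in E, ENNReal.ofReal (Real.exp (β * m)) ∂whiteNoise := (setLIntegral_const _ _).symm
    _ ≤ ∫⁻ g in E, gibbsWeight β K (TorusDistribution.ofLp (randomSeries g)) ∂whiteNoise :=
        setLIntegral_mono' hEm hlow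
    _ ≤ ∫⁻ g, gibbsWeight β K (TorusDistribution.ofLp (randomSeries g)) ∂whiteNoise :=
        setLIntegral_le_lintegral _ _
    _ = ∫⁻ u, gibbsWeight β K u ∂gaussianMeasure :=
        (lintegral_map' (aemeasurable_gibbsWeight hβ K) measurable_series.aemeasurable).symm

theorem norm_sub_le_iff_eLpNorm {f : Lp ℂ 2 haarT} {F : UnitAddCircle → ℂ} (hF : MemLp F 2 haarT)
    {δ : ℝ} (hδ : 0 ≤ δ) :
    ‖f - hF.toLp F‖ ≤ δ ↔ eLpNorm (⇑f - F) 2 haarT ≤ ENNReal.ofReal δ := by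
  have e : eLpNorm (⇑f - F) 2 haarT = eLpNorm (f - hF.toLp F : Lp ℂ 2 haarT) 2 haarT := by
    refine eLpNorm_congr_ae ?_
    filter_upwards [Lp.coeFn_sub f (hF.toLp F), hF.coeFn_toLp] with x h1 h2
    rw [h1, Pi.sub_apply, Pi.sub_apply, h2]
  rw [e, Lp.norm_def, ENNReal.le_ofReal_iff_toReal_le (Lp.eLpNorm_ne_top _) hδ]

/-- The point is uniformity: `P₀` and `W` are chosen before `l`. -/
theorem IsCompetitor.exists_le_lintegral {K : ℝ≥0∞} {p : ℝ} (hp : 0 ≤ p) {w w' : ℝ → ℂ}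
    {R c₆ c₂ : ℝ} (hR : 0 < R) (hw : IsCompetitor K p w w' R c₆ c₂) :
    ∃ (P₀ : ℝ≥0∞) (W : ℝ), P₀ ≠ 0 ∧ ∀ l : ℝ, 2 * R ≤ l →
      ENNReal.ofReal (Real.exp (l ^ 2 * ((p / 3 * c₆ - c₂) / 2) - W)) * P₀ ≤
        ∫⁻ u, gibbsWeight (p / 6) (K ^ 2) u ∂gaussianMeasure := by
  obtain ⟨δ₁, hδ₁, h6⟩ := exists_lt_lintegral_six_of_near_dil hw.memLp.1 hw.lt_six
  obtain ⟨δ₂, hδ₂, hmass⟩ : ∃ δ₂ : ℝ, 0 < δ₂ ∧ ENNReal.ofReal δ₂ + eLpNorm w 2 volume ≤ K := by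
    obtain ⟨r, hr0, hr⟩ := ENNReal.lt_iff_exists_add_pos_lt.1 hw.mass_lt
    exact ⟨r, hr0, by rw [ENNReal.ofReal_coe_nnreal, add_comm]; exact hr.le⟩
  set δ : ℝ := min δ₁ δ₂ with hδdef
  have hδ : 0 < δ := lt_min hδ₁ hδ₂
  -- One half of `δ` is for the random fluctuation, the other for truncating the Fourier series. `W`
  -- is the mass part of the Cameron-Martin cost, which dilation leaves unchanged.
  refine ⟨whiteNoise {g | ‖randomSeries g‖ ≤ δ / 2}, (eLpNorm w 2 volume).toReal ^ 2 / 2,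
    (smallBall_pos (half_pos hδ)).ne', fun l hl => ?_⟩
  have hl0 : 0 < l := by linarith
  -- The condition `2R ≤ l` confines the dilated profile to one period.
  have hfar : ∀ x : ℝ, 1 / 2 ≤ |x| → R ≤ |l * x| := fun x hx => by
    rw [abs_mul, abs_of_pos hl0]
    nlinarith
  have hv : ∀ x, 1 / 2 ≤ |x| → dil l w x = 0 := fun x hx => by
    rw [dil, hw.eq_zero _ (hfar x hx), mul_zero]
  have hv' : ∀ x, 1 / 2 ≤ |x| → (l : ℂ) * dil l w' x = 0 := fun x hx => by
    rw [dil, hw.eq_zero' _ (hfar x hx), mul_zero, mul_zero]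
  have hv2 := MemLp.dil hl0 hw.memLp
  have hv2' : MemLp (fun x => (l : ℂ) * dil l w' x) 2 volume := (MemLp.dil hl0 hw.memLp').const_mul _
  have hF := memLp_periodize hv2
  set F := periodize (dil l w) with hFdef
  have hcoe : fourierCoeff (hF.toLp F) = fourierCoeff F :=
    fourierCoeff_congr_ae hF.coeFn_toLp
  have hsum := hasSum_fourier_series_L2 (hF.toLp F)
  rw [hcoe] at hsum
  -- `S` depends on `l`, which is harmless: the bound on the cost does not depend on `S`.
  obtain ⟨S, hS⟩ := ((Metric.tendsto_nhds.1 hsum) (δ / 2) (half_pos hδ)).exists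
  rw [dist_eq_norm] at hS
  have hnorm' : (eLpNorm (fun x => (l : ℂ) * dil l w' x) 2 volume).toReal ^ 2 ≤ l ^ 2 * c₂ := by
    have e : eLpNorm (fun x => (l : ℂ) * dil l w' x) 2 volume =
        ENNReal.ofReal l * eLpNorm w' 2 volume := by
      have := eLpNorm_const_smul (l : ℂ) (dil l w') 2 volume
      rw [eLpNorm_dil hl0, ← ofReal_norm, Complex.norm_real, Real.norm_of_nonneg hl0.le] at this
      exact this
    rw [e, ENNReal.toReal_mul, ENNReal.toReal_ofReal hl0.le, mul_pow]
    exact mul_le_mul_of_nonneg_left hw.energy_le (by positivity)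
  have hcost := sum_bracket_sq_mul_le hv2 hv2' hv hv' (hw.weakDeriv.dil hl0) S
  rw [eLpNorm_dil hl0] at hcost
  refine le_trans (mul_le_mul_left (ENNReal.ofReal_le_ofReal (Real.exp_le_exp.2 ?_)) _)
    (le_lintegral_gibbsWeight (β := p / 6) (by positivity) (K ^ 2) S (fourierCoeff F)
      (m := l ^ 2 * c₆) (mul_nonneg (by positivity) hw.six_nonneg) fun f hf => ?_)
  -- The exponent is at least `(p/6) l² c₆ - ½(‖w‖² + l² c₂)`.
  · nlinarith
  · have hfF : ‖f - hF.toLp F‖ ≤ δ := by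
      have := norm_add_le (f - ∑ n ∈ S, fourierCoeff F n • (fourierLp 2 n : Lp ℂ 2 haarT))
        (∑ n ∈ S, fourierCoeff F n • (fourierLp 2 n : Lp ℂ 2 haarT) - hF.toLp F)
      rw [sub_add_sub_cancel] at this
      linarith
    rw [norm_sub_le_iff_eLpNorm hF hδ.le] at hfF
    have hf := Lp.aestronglyMeasurable f
    constructor
    · rw [← eLpNorm_two_sq]
      refine pow_le_pow_left₀ zero_le ?_ 2
      have h1 := eLpNorm_add_le (hf.sub hF.1) hF.1 (p := 2) (by norm_num)
      rw [sub_add_cancel] at h1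
      refine h1.trans (le_trans (add_le_add (hfF.trans (ENNReal.ofReal_le_ofReal
        (min_le_right _ _))) (le_of_eq ?_)) hmass)
      rw [hFdef, eLpNorm_periodize hv, eLpNorm_dil hl0]
    · rw [ENNReal.ofReal_mul (by positivity)]
      exact h6 l hl0 hv f hf (hfF.trans (ENNReal.ofReal_le_ofReal (min_le_left _ _)))

/-- Above the critical power the partition function diverges at the optimal mass threshold. -/
theorem lintegral_gibbsWeight_eq_top {Q : ℝ → ℝ} (hQ : IsGNSOptimiser Q) {p : ℝ} (hp : 1 < p) :
    ∫⁻ u, gibbsWeight (p / 6) (eLpNorm Q 2 volume ^ 2) u ∂gaussianMeasure = ⊤ := by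
  obtain ⟨w, w', R, c₆, c₂, hR, hw⟩ := exists_isCompetitor hQ hp
  obtain ⟨P₀, W, hP₀, h⟩ := hw.exists_le_lintegral (by linarith) hR
  have hκ : 0 < (p / 3 * c₆ - c₂) / 2 := by linarith [hw.lt]
  have hlim : Tendsto (fun l : ℝ =>
      ENNReal.ofReal (Real.exp (l ^ 2 * ((p / 3 * c₆ - c₂) / 2) - W)) * P₀) atTop (𝓝 (⊤ * P₀)) := by
    refine ENNReal.Tendsto.mul_const (ENNReal.tendsto_ofReal_atTop.comp
      (Real.tendsto_exp_atTop.comp ?_)) (Or.inl ENNReal.top_ne_zero)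
    exact tendsto_atTop_add_const_right _ (-W)
      ((tendsto_pow_atTop two_ne_zero).atTop_mul_const hκ)
  rw [ENNReal.top_mul hP₀] at hlim
  exact top_le_iff.1 (le_of_tendsto hlim
    ((eventually_ge_atTop (2 * R)).mono fun l hl => h l hl))

end TorusGibbs

/-! ### The main theorem -/

theorem proposition2p2 (Q : ℝ → ℝ) (hQ : TorusGibbs.IsGNSOptimiser Q) (p : ℝ) (hp : 1 < p) :
    -- the integral of the truncated weight is infinite
    (AEMeasurable (TorusGibbs.gibbsWeight (p / 6) (eLpNorm Q 2 volume ^ 2))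
        TorusGibbs.gaussianMeasure ∧
      ∫⁻ u, TorusGibbs.gibbsWeight (p / 6) (eLpNorm Q 2 volume ^ 2) u
        ∂TorusGibbs.gaussianMeasure = ⊤) ∧
    -- the Gibbs density, with any normalising constant `Z`, is not in `L^p`
    (AEMeasurable (TorusGibbs.gibbsWeight (1 / 6) (eLpNorm Q 2 volume ^ 2))
        TorusGibbs.gaussianMeasure ∧
      ∀ Z : ℝ≥0∞, Z ≠ 0 → Z ≠ ⊤ →
        ¬ MemLp (fun u => Z⁻¹ * TorusGibbs.gibbsWeight (1 / 6) (eLpNorm Q 2 volume ^ 2) u)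
          (ENNReal.ofReal p) TorusGibbs.gaussianMeasure) := by
  have hp0 : 0 < p := by linarith
  have htop := TorusGibbs.lintegral_gibbsWeight_eq_top hQ hp
  refine ⟨⟨TorusGibbs.aemeasurable_gibbsWeight (by positivity) _, htop⟩,
    TorusGibbs.aemeasurable_gibbsWeight (by norm_num) _, fun Z hZ hZ' hmem => ?_⟩
  -- The `p`-th power of the density is `Z⁻ᵖ` times the weight with `p/6` in place of `1/6`, so
  -- membership in `L^p` would make the divergent integral finite.
  have h := lintegral_rpow_enorm_lt_top_of_eLpNorm_lt_top
    (by simpa using hp0) ENNReal.ofReal_ne_top hmem.2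
  rw [ENNReal.toReal_ofReal hp0.le] at h
  simp_rw [enorm_eq_self, ENNReal.mul_rpow_of_nonneg _ _ hp0.le,
    TorusGibbs.gibbsWeight_rpow hp0] at h
  rw [lintegral_const_mul' _ _ (ENNReal.rpow_ne_top_of_nonneg hp0.le (ENNReal.inv_ne_top.2 hZ)),
    mul_one_div, htop, ENNReal.mul_top] at h
  · exact lt_irrefl _ h
  -- `Z ≠ ⊤` excludes the product `0 * ⊤ = 0`.
  · exact (ENNReal.rpow_pos (ENNReal.inv_pos.2 hZ') (ENNReal.inv_ne_top.2 hZ)).ne'
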